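/- Let $\mu\ge 0$ and let $B^2$ be the closed unit disk. Put $W_\mu(x,y)=(1-x^2-y^2)^{\mu-1/2}$ and $a_\mu=(\mu+\tfrac12)/\pi$. Consider the real space $L^2(W_\mu;B^2)$ with inner product $\langle f,g\rangle_\mu=a_\mu\int_{B^2}f\,g\,W_\mu\,dx\,dy$. Let $\mathcal V_k^2(W_\mu)$ be the space of polynomials in $(x,y)$ of total degree at most $k$ that are orthogonal to all polynomials of degree less than $k$, let $\operatorname{proj}_k^\mu$ be the orthogonal projection of $L^2(W_\mu;B^2)$ onto $\mathcal V_k^2(W_\mu)$, and let $S_n^\mu f=\sum_{k=0}^n\operatorname{proj}_k^\mu f$. For an angle $\theta$ and $-1\le t\le 1$ let $$\mathcal R_\theta^\mu(f;t)=\int_{-\sqrt{1-t^2}}^{\sqrt{1-t^2}}(fW_\mu)(t\cos\theta-s\sin\theta,\;t\sin\theta+s\cos\theta)\,ds$$ be the attenuated Radon projection, the integral of $fW_\mu$ over the chord $\{x\cos\theta+y\sin\theta=t\}\cap B^2$. Write $(a)_k=a(a+1)\cdots(a+k-1)$. Let $$C_k^\lambda(t)=\sum_{0\le 2j\le k}(-1)^j\frac{(\lambda)_{k-j}}{j!\,(k-2j)!}(2t)^{k-2j}$$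 be the Gegenbauer polynomials, and let $p_l^{(\alpha,\beta)}$ be the Jacobi polynomial of degree $l$ that is orthonormal on $[-1,1]$ for the weight $(1-t)^\alpha(1+t)^\beta$ divided by its integral over $[-1,1]$. For $0\le 2l\le k$ let $$h_{l,k}=\left(\frac{\Gamma(k-2l+\mu+\frac32)}{\Gamma(\mu+\frac32)\,\Gamma(k-2l+1)}\right)^{1/2},\qquad H_{l,k}=h_{l,k}\,p_l^{(\mu-\frac12,\,k-2l)}(1),\qquad \lambda_{l,k}=H_{l,k}^{-2}.$$ With $x=r\cos\phi$, $y=r\sin\phi$, let $$P_{l,\varepsilon}^k(x,y)=\sigma_{l,k}\,h_{l,k}\,p_l^{(\mu-\frac12,\,k-2l)}(2r^2-1)\,r^{k-2l}S_{k-2l,\varepsilon}(\phi),$$ where $S_{j,0}(\phi)=\cos j\phi$, $S_{j,1}(\phi)=\sin j\phi$, $\sigma_{l,k}=\sqrt2$ if $2l<k$ and $\sigma_{l,k}=1$ if $2l=k$. These are polynomials in $(x,y)$. Define $$D_k^{\mu+1/2}(\xi;x,y)=\sum_{0\le 2l\le k}\lambda_{l,k}P_{l,0}^k(\cos\xi,\sin\xi)P_{l,0}^k(x,y)+\sum_{0\le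 2l\le k-1}\lambda_{l,k}P_{l,1}^k(\cos\xi,\sin\xi)P_{l,1}^k(x,y),$$ $$\Phi_n^\mu(\xi,t;x,y)=\sum_{k=0}^n\frac{k+\mu+\frac12}{\mu+\frac12}\,C_k^{\mu+1/2}(t)\,D_k^{\mu+1/2}(\xi;x,y).$$ Let $f\in L^2(W_\mu;B^2)$. For every angle $\theta$ the integral defining $\mathcal R_\theta^\mu(f;t)$ exists for almost every $t\in[-1,1]$, and $t\mapsto\mathcal R_\theta^\mu(f;t)\,\Phi_n^\mu(\theta,t;x,y)$ is integrable on $[-1,1]$ for all $n\ge 0$ and $x,y\in\mathbb R$. For every $m\ge 0$, $S_{2m}^\mu f$ is (a.e. equal to) a polynomial of degree at most $2m$ which satisfies, for all $x,y\in\mathbb R$, $$S_{2m}^\mu(f;x,y)=\frac1{2m+1}\sum_{\nu=0}^{2m}a_\mu\int_{-1}^1\mathcal R_{\phi_\nu}^\mu(f;t)\,\Phi_{2m}^\mu(\phi_\nu,t;x,y)\,dt,\qquad \phi_\nu=\frac{2\nu\pi}{2m+1}.$$ Likewise, for every $n\ge 0$, $S_n^\mu f$ is (a.e. equal to) a polynomial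 of degree at most $n$ which satisfies, for all $x,y\in\mathbb R$, with $\xi_\nu=\frac{\nu\pi}{n+1}$, $$S_n^\mu(f;x,y)=\frac1{n+1}\sum_{\nu=0}^{n}a_\mu\int_{-1}^1\mathcal R_{\xi_\nu}^\mu(f;t)\,\Phi_n^\mu(\xi_\nu,t;x,y)\,dt=\frac1{2n+2}\sum_{\nu=0}^{2n+1}a_\mu\int_{-1}^1\mathcal R_{\xi_\nu}^\mu(f;t)\,\Phi_n^\mu(\xi_\nu,t;x,y)\,dt.$$ -/

import Mathlib

open MeasureTheory Filter

noncomputable section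

namespace AttenuatedRadon

/-- The closed unit disk of the plane. -/
def disk : Set (ℝ × ℝ) := {p | p.1 ^ 2 + p.2 ^ 2 ≤ 1}

/-- The weight `W_μ(x,y) = (1 - x² - y²)^(μ - 1/2)`. -/
def weight (μ : ℝ) (p : ℝ × ℝ) : ℝ := (1 - p.1 ^ 2 - p.2 ^ 2) ^ (μ - 1 / 2)

/-- The normalization constant `a_μ = (μ + 1/2)/π = 1 / ∫ W_μ` over the disk. -/
def aConst (μ : ℝ) : ℝ := (μ + 1 / 2) / Real.pi

/-- The measure `a_μ W_μ(x,y) dx dy` on the unit disk. -/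
def diskMeasure (μ : ℝ) : Measure (ℝ × ℝ) :=
  (volume.restrict disk).withDensity (fun p => ENNReal.ofReal (aConst μ * weight μ p))

/-! ### Spaces of orthogonal polynomials and orthogonal projections -/

/-- The value at `p` of a polynomial in two variables. -/
def evalAt (P : MvPolynomial (Fin 2) ℝ) (p : ℝ × ℝ) : ℝ := MvPolynomial.eval ![p.1, p.2] P

/-- The subspace of `L²` of the disk, with its inner product
`⟨f, g⟩ = a_μ ∫ f g W_μ`, formed by the polynomials of total degree at most `n`. -/
def polySpace (μ : ℝ) (n : ℕ) : Submodule ℝ (Lp ℝ 2 (diskMeasure μ)) where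
  carrier := {g | ∃ P ∈ MvPolynomial.restrictTotalDegree (Fin 2) ℝ n,
    g =ᵐ[diskMeasure μ] evalAt P}
  zero_mem' := ⟨0, Submodule.zero_mem _, by
    filter_upwards [Lp.coeFn_zero ℝ 2 (diskMeasure μ)] with p hp
    rw [hp]
    simp [evalAt]⟩
  add_mem' := by
    rintro g₁ g₂ ⟨P₁, hP₁, h₁⟩ ⟨P₂, hP₂, h₂⟩
    refine ⟨P₁ + P₂, Submodule.add_mem _ hP₁ hP₂, ?_⟩
    filter_upwards [Lp.coeFn_add g₁ g₂, h₁, h₂] with p hp e₁ e₂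
    rw [hp, Pi.add_apply, e₁, e₂]
    simp [evalAt]
  smul_mem' := by
    rintro c g ⟨P, hP, h⟩
    refine ⟨c • P, Submodule.smul_mem _ c hP, ?_⟩
    filter_upwards [Lp.coeFn_smul c g, h] with p hp e
    rw [hp, Pi.smul_apply, e]
    simp [evalAt]

instance polySpace_finiteDimensional (μ : ℝ) (n : ℕ) :
    FiniteDimensional ℝ (polySpace μ n) := by
  have key : ∀ (g₁ g₂ : Lp ℝ 2 (diskMeasure μ)) (P : MvPolynomial (Fin 2) ℝ),
      g₁ =ᵐ[diskMeasure μ] evalAt P → g₂ =ᵐ[diskMeasure μ] evalAt P → g₁ = g₂ :=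
    fun g₁ g₂ P h₁ h₂ => Lp.ext (h₁.trans h₂.symm)
  let T : Submodule ℝ (MvPolynomial.restrictTotalDegree (Fin 2) ℝ n) :=
    { carrier := {P | MemLp (evalAt P.1) 2 (diskMeasure μ)}
      zero_mem' := by
        have : evalAt (0 : MvPolynomial (Fin 2) ℝ) = 0 := by ext; simp [evalAt]
        simp [this]
      add_mem' := by
        intro P Q hP hQ
        have : evalAt (P.1 + Q.1) = evalAt P.1 + evalAt Q.1 := by ext; simp [evalAt]
        simpa [this] using MemLp.add hP hQ
      smul_mem' := by
        intro c P hP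
        have : evalAt (c • P.1) = c • evalAt P.1 := by ext; simp [evalAt]
        simpa [this] using MemLp.const_smul hP c }
  let L : T →ₗ[ℝ] Lp ℝ 2 (diskMeasure μ) :=
    { toFun := fun P => P.2.toLp
      map_add' := by
        intro P Q
        refine key _ _ (P.1.1 + Q.1.1) (MemLp.coeFn_toLp _) ?_
        filter_upwards [Lp.coeFn_add P.2.toLp Q.2.toLp, P.2.coeFn_toLp, Q.2.coeFn_toLp]
          with p h e₁ e₂
        rw [h, Pi.add_apply, e₁, e₂]
        simp [evalAt]
      map_smul' := by
        intro c P
        refine key _ _ (c • P.1.1) (MemLp.coeFn_toLp _) ?_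
        filter_upwards [Lp.coeFn_smul c P.2.toLp, P.2.coeFn_toLp] with p h e
        rw [RingHom.id_apply, h, Pi.smul_apply, e]
        simp [evalAt] }
  have hle : polySpace μ n ≤ LinearMap.range L := by
    rintro g ⟨P, hP, h⟩
    have hm : MemLp (evalAt P) 2 (diskMeasure μ) := (memLp_congr_ae h).1 (Lp.memLp g)
    exact ⟨⟨⟨P, hP⟩, hm⟩, key _ _ P hm.coeFn_toLp h⟩
  exact Submodule.finiteDimensional_of_le hle

/-- The space `V_k` of orthogonal polynomials of degree `k`: the polynomials of degree at most `k`
orthogonal to all polynomials of degree less than `k`. -/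
def orthoSpace (μ : ℝ) (k : ℕ) : Submodule ℝ (Lp ℝ 2 (diskMeasure μ)) :=
  polySpace μ k ⊓ ⨅ j ∈ Finset.range k, (polySpace μ j)ᗮ

instance orthoSpace_finiteDimensional (μ : ℝ) (k : ℕ) :
    FiniteDimensional ℝ (orthoSpace μ k) :=
  Submodule.finiteDimensional_of_le (inf_le_left : orthoSpace μ k ≤ polySpace μ k)

/-- The orthogonal projection of `L²` onto `V_k`. -/
def proj (μ : ℝ) (k : ℕ) (f : Lp ℝ 2 (diskMeasure μ)) : Lp ℝ 2 (diskMeasure μ) :=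
  (orthoSpace μ k).starProjection f

/-- The partial sum `S_n f` of the orthogonal expansion. -/
def partialSum (μ : ℝ) (n : ℕ) (f : Lp ℝ 2 (diskMeasure μ)) : Lp ℝ 2 (diskMeasure μ) :=
  ∑ k ∈ Finset.range (n + 1), proj μ k f

/-! ### Attenuated Radon projections -/

/-- The point with coordinate `t` along `(cos θ, sin θ)` and `s` along `(-sin θ, cos θ)`. -/
def linePoint (θ t s : ℝ) : ℝ × ℝ :=
  (t * Real.cos θ - s * Real.sin θ, t * Real.sin θ + s * Real.cos θ)

/-- The attenuated Radon projection: the integral, with respect to arc length, of `f W_μ` over the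
segment cut out of the disk by the line `x cos θ + y sin θ = t`. -/
def radon (μ θ : ℝ) (f : ℝ × ℝ → ℝ) (t : ℝ) : ℝ :=
  ∫ s in (-√(1 - t ^ 2))..√(1 - t ^ 2), f (linePoint θ t s) * weight μ (linePoint θ t s)

/-! ### Classical orthogonal polynomials in one variable -/

/-- The rising factorial `(a)_k = a (a+1) ⋯ (a+k-1)`. -/
def rising (a : ℝ) (k : ℕ) : ℝ := (ascPochhammer ℝ k).eval a

/-- The Gegenbauer polynomial `C_k^lam`, for `lam > 0`. -/
def gegenbauer (lam : ℝ) (k : ℕ) (t : ℝ) : ℝ :=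
  ∑ j ∈ Finset.range (k / 2 + 1),
    (-1) ^ j * rising lam (k - j) / ((j.factorial : ℝ) * ((k - 2 * j).factorial : ℝ)) *
      (2 * t) ^ (k - 2 * j)

/-- The Jacobi polynomial `P_n^(α,β)` in its classical normalization, for `α, β > -1`. -/
def jacobi (α β : ℝ) (n : ℕ) (t : ℝ) : ℝ :=
  ∑ s ∈ Finset.range (n + 1),
    rising (α + 1 + s) (n - s) * rising (n + α + β + 1) s /
      ((s.factorial : ℝ) * ((n - s).factorial : ℝ)) * ((t - 1) / 2) ^ s

/-- The Jacobi weight `(1-t)^α (1+t)^β`. -/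
def jacobiWeight (α β t : ℝ) : ℝ := (1 - t) ^ α * (1 + t) ^ β

/-- The Jacobi polynomial `p_n^(α,β)`, orthonormal for the Jacobi weight normalized to have
integral one over `[-1,1]`. -/
def jacobiON (α β : ℝ) (n : ℕ) (t : ℝ) : ℝ :=
  jacobi α β n t /
    √((∫ u in (-1 : ℝ)..1, jacobi α β n u ^ 2 * jacobiWeight α β u) /
      ∫ u in (-1 : ℝ)..1, jacobiWeight α β u)

/-! ### The orthonormal basis and the kernels -/

/-- `S_{j,0}(φ) = cos jφ` and `S_{j,1}(φ) = sin jφ`. -/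
def trig (j : ℕ) (ε : Fin 2) (φ : ℝ) : ℝ := if ε = 0 then Real.cos (j * φ) else Real.sin (j * φ)

/-- The polynomial in `x, y` which is `r^j S_{j,ε}(φ)` in polar coordinates: the real or the
imaginary part of `(x + iy)^j`. -/
def solid (j : ℕ) (ε : Fin 2) (p : ℝ × ℝ) : ℝ :=
  if ε = 0 then ((⟨p.1, p.2⟩ : ℂ) ^ j).re else ((⟨p.1, p.2⟩ : ℂ) ^ j).im

theorem solid_polar (j : ℕ) (ε : Fin 2) (r φ : ℝ) :
    solid j ε (r * Real.cos φ, r * Real.sin φ) = r ^ j * trig j ε φ := by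
  have h : ((⟨r * Real.cos φ, r * Real.sin φ⟩ : ℂ) ^ j)
      = ⟨r ^ j * Real.cos (j * φ), r ^ j * Real.sin (j * φ)⟩ := by
    have e : (⟨r * Real.cos φ, r * Real.sin φ⟩ : ℂ) =
        r * (Complex.cos φ + Complex.sin φ * Complex.I) := by
      apply Complex.ext <;> simp [← Complex.ofReal_cos, ← Complex.ofReal_sin]
    rw [e, mul_pow, Complex.cos_add_sin_mul_I_pow,
      show ((j : ℂ) * (φ : ℂ)) = ((j * φ : ℝ) : ℂ) by push_cast; rfl,
      ← Complex.ofReal_pow, ← Complex.ofReal_cos, ← Complex.ofReal_sin]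
    apply Complex.ext <;> simp [-Complex.ofReal_cos, -Complex.ofReal_sin, -Complex.ofReal_mul,
      -Complex.ofReal_pow]
  unfold solid trig
  split_ifs <;> simp [h]

/-- `h_{l,k} = (Γ(k-2l+μ+3/2) / (Γ(μ+3/2) Γ(k-2l+1)))^(1/2)`, for `2l ≤ k`. -/
def hConst (μ : ℝ) (l k : ℕ) : ℝ :=
  √(Real.Gamma ((k - 2 * l : ℕ) + μ + 3 / 2) /
    (Real.Gamma (μ + 3 / 2) * Real.Gamma ((k - 2 * l : ℕ) + 1)))

/-- The element `P_{l,ε}^k` of the orthonormal basis of `V_k`. The factor `√2` for `2l < k`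
normalizes the trigonometric functions of positive frequency. -/
def basisFn (μ : ℝ) (k l : ℕ) (ε : Fin 2) (p : ℝ × ℝ) : ℝ :=
  (if 2 * l < k then √2 else 1) * hConst μ l k *
    jacobiON (μ - 1 / 2) (k - 2 * l : ℕ) l (2 * (p.1 ^ 2 + p.2 ^ 2) - 1) * solid (k - 2 * l) ε p

/-- `H_{l,k} = h_{l,k} p_l^(μ-1/2,k-2l)(1)`. -/
def HConst (μ : ℝ) (l k : ℕ) : ℝ :=
  hConst μ l k * jacobiON (μ - 1 / 2) (k - 2 * l : ℕ) l 1

/-- `λ_{l,k} = H_{l,k}^(-2)`. -/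
def lambdaConst (μ : ℝ) (l k : ℕ) : ℝ := (HConst μ l k ^ 2)⁻¹

/-- The polynomial `D_k(ξ; x, y)`: the sum of
`λ_{l,k} P_{l,ε}^k(cos ξ, sin ξ) P_{l,ε}^k(x, y)` over the basis of `V_k`, that is over
`0 ≤ 2l ≤ k` for `ε = 0` and over `0 ≤ 2l ≤ k - 1` for `ε = 1`. -/
def dKernel (μ : ℝ) (k : ℕ) (ξ : ℝ) (p : ℝ × ℝ) : ℝ :=
  (∑ l ∈ Finset.range (k + 1) with 2 * l ≤ k,
    lambdaConst μ l k * basisFn μ k l 0 (Real.cos ξ, Real.sin ξ) * basisFn μ k l 0 p) +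
  ∑ l ∈ Finset.range (k + 1) with 2 * l < k,
    lambdaConst μ l k * basisFn μ k l 1 (Real.cos ξ, Real.sin ξ) * basisFn μ k l 1 p

/-- The kernel `Φ_n(ξ, t; x, y)`. -/
def phiKernel (μ : ℝ) (n : ℕ) (ξ t : ℝ) (p : ℝ × ℝ) : ℝ :=
  ∑ k ∈ Finset.range (n + 1),
    (k + μ + 1 / 2) / (μ + 1 / 2) * gegenbauer (μ + 1 / 2) k t * dKernel μ k ξ p

/-- The angles `φ_ν = 2νπ/(2m+1)`, equally spaced on the whole circle for `0 ≤ ν ≤ 2m`. -/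
def phiAngle (m ν : ℕ) : ℝ := 2 * ν * Real.pi / (2 * m + 1)

/-- The angles `ξ_ν = νπ/(n+1)`, equally spaced on a half circle for `0 ≤ ν ≤ n` and on the whole
circle for `0 ≤ ν ≤ 2n+1`. -/
def xiAngle (n ν : ℕ) : ℝ := ν * Real.pi / (n + 1)

end AttenuatedRadon

end

noncomputable section

namespace AttenuatedRadon

/-! ### Rising factorials and finite differences -/

/-! Write `Z` for the disk polynomials `zernike`: a Jacobi polynomial in `2r² - 1` times the real or
imaginary part of `(x + iy)^(k-2l)`. In polar coordinates they are orthogonal for the weight, and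
they span all polynomials. Dividing by squared norms gives the reproducing kernel `K_k(z, p)` of
`V_k`, so `S_n f(p)` is the integral of `f(z) ∑ K_k(z, p)` over `k ≤ n`. Since polynomial identities
on the plane are used, this fixes the polynomial at every point `p`, also outside the disk.

The kernel is a mean of ridge polynomials. Writing `2x = w + w̄` with `w = x + iy` and expanding,
`C_k(x)` becomes a combination of the `Z` with cosine parts (`gegenbauer_eq_sum_zernike`). After a
rotation, `C_k(⟨z, ξ⟩)` is a trigonometric sum in `ξ` with frequencies `k - 2l` and coefficients
`Z(z)`. The polynomial `D_k(ξ; p)` is a sum of the same shape with coefficients `Z(p)`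
(`dKernel_eq`). Their product involves only even frequencies of size at most `2n`. Any equal-weight
rule exact for these, as all three families of angles are, removes the cross terms; the diagonal
that survives is `K_k(z, p)`, provided the constants match
(`IsQuadrature.sum_gegenbauer_mul_dKernel`, `reproConst_mul_normSq`).

Finally, Fubini in coordinates rotated by `θ` turns the integral of `f` against a function of `⟨z,
θ⟩` into an integral of the Radon projection of `f` (`integral_radon_mul`). -/

@[simp] theorem rising_zero (a : ℝ) : rising a 0 = 1 := by simp [rising]

theorem rising_succ (a : ℝ) (k : ℕ) : rising a (k + 1) = rising a k * (a + k) := by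
  simp [rising, ascPochhammer_succ_eval]

theorem rising_succ_left (a : ℝ) (k : ℕ) : rising a (k + 1) = a * rising (a + 1) k := by
  simp [rising, ascPochhammer_succ_left, Polynomial.eval_comp]

theorem rising_add (a : ℝ) (m n : ℕ) : rising a (m + n) = rising a m * rising (a + m) n := by
  induction n with
  | zero => simp
  | succ n ih =>
    rw [← add_assoc, rising_succ, ih, rising_succ]
    push_cast
    ring

theorem rising_pos {a : ℝ} (ha : 0 < a) (k : ℕ) : 0 < rising a k := ascPochhammer_pos k a ha

theorem rising_natCast_add_one (j n : ℕ) :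
    rising ((j : ℝ) + 1) n = ((j + n).factorial : ℝ) / (j.factorial : ℝ) := by
  rw [eq_div_iff (by positivity), mul_comm]
  exact factorial_mul_ascPochhammer ℝ j n

/-- The Chu–Vandermonde identity. -/
theorem sum_choose_mul_rising (n : ℕ) (a b : ℝ) :
    ∑ s ∈ Finset.range (n + 1), (-1) ^ s * (n.choose s : ℝ) * rising (a + s) (n - s) * rising b s
      = rising (a - b) n := by
  induction n generalizing a b with
  | zero => simp
  | succ n ih =>
    have h1 : ∑ s ∈ Finset.range (n + 1 + 1), (-1) ^ s * ((n + 1).choose s : ℝ) *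
          rising (a + s) (n + 1 - s) * rising b s
        = (∑ s ∈ Finset.range (n + 1 + 1), (-1) ^ s * (n.choose s : ℝ) *
            rising (a + s) (n + 1 - s) * rising b s)
          + ∑ s ∈ Finset.range (n + 1), (-1) ^ (s + 1) * (n.choose s : ℝ) *
            rising (a + (s + 1 : ℕ)) (n + 1 - (s + 1)) * rising b (s + 1) := by
      rw [Finset.sum_range_succ' _ (n + 1), Finset.sum_range_succ' _ (n + 1), add_right_comm,
        ← Finset.sum_add_distrib]
      simp only [Nat.choose_zero_right, add_left_inj]
      refine Finset.sum_congr rfl fun s _ => ?_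
      rw [Nat.choose_succ_succ]
      push_cast
      ring
    -- All terms carry the same last factor `a + n`, and the term `s = n + 1` has a zero binomial
    -- coefficient. In `h3` the shift of both `a` and `b` by one leaves `a - b` unchanged. The
    -- factors add up to `(a + n) - b`.
    have h2 : ∑ s ∈ Finset.range (n + 1 + 1), (-1) ^ s * (n.choose s : ℝ) *
            rising (a + s) (n + 1 - s) * rising b s = (a + n) * rising (a - b) n := by
      rw [Finset.sum_range_succ, Nat.choose_succ_self, ← ih, Finset.mul_sum]
      simp only [Nat.cast_zero, mul_zero, zero_mul, add_zero]
      refine Finset.sum_congr rfl fun s hs => ?_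
      have hs' : s ≤ n := Nat.lt_succ_iff.1 (Finset.mem_range.1 hs)
      rw [Nat.sub_add_comm hs', rising_succ, Nat.cast_sub hs']
      ring
    have h3 : ∑ s ∈ Finset.range (n + 1), (-1) ^ (s + 1) * (n.choose s : ℝ) *
            rising (a + (s + 1 : ℕ)) (n + 1 - (s + 1)) * rising b (s + 1)
        = - b * rising (a - b) n := by
      have := ih (a + 1) (b + 1)
      rw [add_sub_add_right_eq_sub] at this
      rw [← this, Finset.mul_sum]
      refine Finset.sum_congr rfl fun s _ => ?_
      rw [rising_succ_left, Nat.add_sub_add_right, pow_succ]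
      push_cast
      rw [show a + ((s : ℝ) + 1) = a + 1 + s by ring]
      ring
    rw [h1, h2, h3, rising_succ]
    ring

/-- One step of Pascal's rule for alternating binomial sums. -/
theorem sum_choose_alternating_succ (l : ℕ) (g : ℕ → ℝ) :
    ∑ s ∈ Finset.range (l + 1 + 1), (-1) ^ s * ((l + 1).choose s : ℝ) * g s
      = ∑ s ∈ Finset.range (l + 1), (-1) ^ s * (l.choose s : ℝ) * g s
        - ∑ s ∈ Finset.range (l + 1), (-1) ^ s * (l.choose s : ℝ) * g (s + 1) := by
  have h : ∑ s ∈ Finset.range (l + 1), (-1) ^ s * (l.choose s : ℝ) * g s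
      = ∑ s ∈ Finset.range (l + 1 + 1), (-1) ^ s * (l.choose s : ℝ) * g s := by
    rw [Finset.sum_range_succ _ (l + 1)]
    simp
  rw [h, Finset.sum_range_succ' _ (l + 1), Finset.sum_range_succ' _ (l + 1), add_sub_right_comm,
    ← Finset.sum_sub_distrib]
  simp only [Nat.choose_zero_right, add_left_inj]
  refine Finset.sum_congr rfl fun s _ => ?_
  rw [Nat.choose_succ_succ]
  push_cast
  ring

/-- An `l`-th finite difference kills polynomials of degree below `l`; each difference of a rising
factorial lowers its length by one. -/
theorem sum_choose_alternating_rising (l r : ℕ) (hr : r < l) (x : ℝ) :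
    ∑ s ∈ Finset.range (l + 1), (-1) ^ s * (l.choose s : ℝ) * rising (x + s) r = 0 := by
  induction l generalizing r x with
  | zero => omega
  | succ l ih =>
    rw [sum_choose_alternating_succ _ (fun s => rising (x + s) r), ← Finset.sum_sub_distrib]
    cases r with
    | zero => simp
    | succ r =>
      rw [← mul_zero (-((r : ℝ) + 1)), ← ih r (by omega) (x + 1), Finset.mul_sum]
      refine Finset.sum_congr rfl fun s _ => ?_
      rw [rising_succ_left (x + s), rising_succ (x + (s + 1 : ℕ))]
      push_cast
      rw [show x + ((s : ℝ) + 1) = x + 1 + s by ring, show x + (s : ℝ) + 1 = x + 1 + s by ring]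
      ring

theorem sum_choose_alternating_inv (l : ℕ) {x : ℝ} (hx : 0 < x) :
    ∑ s ∈ Finset.range (l + 1), (-1) ^ s * (l.choose s : ℝ) * (x + s)⁻¹
      = l.factorial / rising x (l + 1) := by
  induction l generalizing x with
  | zero => simp [rising_succ]
  | succ l ih =>
    rw [sum_choose_alternating_succ _ (fun s => (x + s)⁻¹), ih hx]
    have := ih (x := x + 1) (by linarith)
    simp only [add_assoc, add_comm (1 : ℝ)] at this
    push_cast
    rw [this]
    have h1 : rising x (l + 1) = x * rising (x + 1) l := rising_succ_left x l
    have h2 : rising (x + 1) (l + 1) = rising (x + 1) l * (x + 1 + l) := rising_succ _ _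
    have h3 : rising x (l + 1 + 1) = x * (rising (x + 1) l * (x + 1 + l)) := by
      rw [rising_succ_left, h2]
    have h4 := (rising_pos (a := x + 1) (by linarith) l).ne'
    have h5 : x + 1 + l ≠ 0 := by positivity
    rw [h1, h2, h3, Nat.factorial_succ]
    push_cast
    field_simp
    ring

/-! ### Jacobi polynomials -/

/-- The expansion of the Jacobi polynomial at `-1`. -/
theorem jacobi_two_mul_sub_one (α β : ℝ) (l : ℕ) (u : ℝ) :
    jacobi α β l (2 * u - 1) = ∑ i ∈ Finset.range (l + 1),
      (-1) ^ (l - i) * rising (β + 1 + i) (l - i) * rising (l + α + β + 1) i /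
        ((i.factorial : ℝ) * ((l - i).factorial : ℝ)) * u ^ i := by
  have h1 : jacobi α β l (2 * u - 1) = ∑ s ∈ Finset.range (l + 1), ∑ i ∈ Finset.range (s + 1),
      rising (α + 1 + s) (l - s) * rising (l + α + β + 1) s /
      ((s.factorial : ℝ) * ((l - s).factorial : ℝ)) * (u ^ i * (-1) ^ (s - i) * s.choose i) := by
    unfold jacobi
    refine Finset.sum_congr rfl fun s _ => ?_
    rw [show (2 * u - 1 - 1) / 2 = u + (-1) by ring, add_pow, Finset.mul_sum]
  rw [h1, Finset.sum_comm' (t' := Finset.range (l + 1)) (s' := fun i => Finset.Ico i (l + 1))]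
  swap
  · intro s i
    simp only [Finset.mem_range, Finset.mem_Ico]
    omega
  refine Finset.sum_congr rfl fun i hi => ?_
  have hi' : i ≤ l := Nat.lt_succ_iff.1 (Finset.mem_range.1 hi)
  obtain ⟨n, rfl⟩ := Nat.exists_eq_add_of_le hi'
  rw [Finset.sum_Ico_eq_sum_range, show i + n + 1 - i = n + 1 by omega, Nat.add_sub_cancel_left]
  -- After expanding `(u - 1)^s`, the coefficient of `u^i` is a Chu–Vandermonde sum with difference
  -- of parameters `-(β + i + n)`; `hR` reverses the order of the factors to make them positive.
  have hV := sum_choose_mul_rising n (α + 1 + i) ((i + n : ℕ) + α + β + 1 + i)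
  have hR : rising (α + 1 + i - ((i + n : ℕ) + α + β + 1 + i)) n
      = (-1) ^ n * rising (β + 1 + i) n := by
    have : ∀ (n : ℕ) (c : ℝ), rising (-(c + n) + 1) n = (-1) ^ n * rising c n := by
      intro n
      induction n with
      | zero => simp
      | succ n ih =>
        intro c
        rw [rising_succ_left, rising_succ, pow_succ]
        have := ih c
        push_cast
        rw [show -(c + ((n : ℝ) + 1)) + 1 + 1 = -(c + n) + 1 by ring, this]
        ring
    rw [← this]
    congr 1
    push_cast
    ring
  rw [hR] at hV
  rw [← hV, Finset.sum_mul, Finset.sum_div, Finset.sum_mul]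
  refine Finset.sum_congr rfl fun s hs => ?_
  have hs' : s ≤ n := Nat.lt_succ_iff.1 (Finset.mem_range.1 hs)
  obtain ⟨r, rfl⟩ := Nat.exists_eq_add_of_le hs'
  rw [rising_add _ i s, Nat.cast_choose ℝ (Nat.le_add_right i s),
    Nat.cast_choose ℝ (Nat.le_add_right s r), show i + (s + r) - (i + s) = r by omega,
    Nat.add_sub_cancel_left, Nat.add_sub_cancel_left]
  push_cast
  rw [show α + 1 + ((i : ℝ) + s) = α + 1 + i + s by ring]
  field_simp

theorem jacobi_one (α β : ℝ) (l : ℕ) : jacobi α β l 1 = rising (α + 1) l / l.factorial := by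
  unfold jacobi
  rw [Finset.sum_range_succ']
  simp

/-- A term of the moment of order `m` of the Jacobi polynomial for the weight
`(1-u)^α u^j` on `[0,1]`. -/
theorem jacobi_moment_term (α : ℝ) (hα : -1 < α) (j l m s : ℕ) (hs : s ≤ l) :
    rising (α + 1 + s) (l - s) * rising (l + α + j + 1) s /
        ((s.factorial : ℝ) * ((l - s).factorial : ℝ)) *
        ((-1) ^ s * ((j + m).factorial / rising (α + 1 + s) (j + m + 1)))
      = rising (α + 1) l * (j + m).factorial / (rising (α + 1) (l + j) * l.factorial) *
        ((-1) ^ s * (l.choose s : ℝ) *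
          (rising (α + 1) (l + j + s) / rising (α + 1) (j + m + 1 + s))) := by
  have hx : 0 < α + 1 := by linarith
  obtain ⟨r, rfl⟩ := Nat.exists_eq_add_of_le hs
  have e1 := rising_add (α + 1) s r
  have e2 : rising (α + 1) (j + m + 1 + s) = rising (α + 1) s * rising (α + 1 + s) (j + m + 1) := by
    rw [add_comm (j + m + 1), rising_add]
  have e3 := rising_add (α + 1) (s + r + j) s
  rw [show α + 1 + ((s + r + j : ℕ) : ℝ) = (s + r : ℕ) + α + j + 1 by push_cast; ring] at e3
  rw [Nat.cast_choose ℝ (Nat.le_add_right s r), Nat.add_sub_cancel_left, e1, e2, e3]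
  have := (rising_pos hx s).ne'
  have := (rising_pos hx (s + r + j)).ne'
  have := (rising_pos (a := α + 1 + s) (by positivity) (j + m + 1)).ne'
  field_simp

/-- By `jacobi_moment_term` this is an `l`-th finite difference of a quotient of rising factorials.
For `m < l` the quotient is a polynomial in `s` of degree `l - m - 1`, so the difference vanishes.
-/
theorem jacobi_moment_eq_zero (α : ℝ) (hα : -1 < α) (j l m : ℕ) (hm : m < l) :
    ∑ s ∈ Finset.range (l + 1), rising (α + 1 + s) (l - s) * rising (l + α + j + 1) s /
        ((s.factorial : ℝ) * ((l - s).factorial : ℝ)) *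
        ((-1) ^ s * ((j + m).factorial / rising (α + 1 + s) (j + m + 1))) = 0 := by
  have hx : 0 < α + 1 := by linarith
  rw [Finset.sum_congr rfl fun s hs => jacobi_moment_term α hα j l m s
    (Nat.lt_succ_iff.1 (Finset.mem_range.1 hs)), ← Finset.mul_sum]
  obtain ⟨d, rfl⟩ := Nat.exists_eq_add_of_lt hm
  have h : ∀ s : ℕ, rising (α + 1) (m + d + 1 + j + s) / rising (α + 1) (j + m + 1 + s)
      = rising (α + 1 + (j + m + 1 : ℕ) + s) d := by
    intro s
    rw [show m + d + 1 + j + s = (j + m + 1 + s) + d by omega, rising_add,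
      mul_div_cancel_left₀ _ (rising_pos hx _).ne']
    congr 1
    push_cast
    ring
  simp only [h]
  rw [sum_choose_alternating_rising (m + d + 1) d (by omega), mul_zero]

/-- At `m = l` the quotient of rising factorials has exactly one factor left, in the denominator, so
`sum_choose_alternating_inv` evaluates the sum. -/
theorem jacobi_moment_self (α : ℝ) (hα : -1 < α) (j l : ℕ) :
    ∑ s ∈ Finset.range (l + 1), rising (α + 1 + s) (l - s) * rising (l + α + j + 1) s /
        ((s.factorial : ℝ) * ((l - s).factorial : ℝ)) *
        ((-1) ^ s * ((j + l).factorial / rising (α + 1 + s) (j + l + 1)))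
      = rising (α + 1) l * (j + l).factorial /
        (rising (α + 1) (l + j) * rising (l + α + j + 1) (l + 1)) := by
  have hx : 0 < α + 1 := by linarith
  rw [Finset.sum_congr rfl fun s hs => jacobi_moment_term α hα j l l s
    (Nat.lt_succ_iff.1 (Finset.mem_range.1 hs)), ← Finset.mul_sum]
  have h := sum_choose_alternating_inv l (x := l + α + j + 1)
    (by have : (0 : ℝ) ≤ l := by positivity
        have : (0 : ℝ) ≤ j := by positivity
        linarith)
  have h' : ∀ s : ℕ, rising (α + 1) (l + j + s) / rising (α + 1) (j + l + 1 + s)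
      = (l + α + j + 1 + s)⁻¹ := by
    intro s
    rw [show j + l + 1 + s = (l + j + s) + 1 by omega, rising_succ,
      div_mul_cancel_left₀ (rising_pos hx _).ne']
    congr 1
    push_cast
    ring
  simp only [h', h]
  have := (rising_pos hx (l + j)).ne'
  field_simp

/-! ### Beta integrals and the orthogonality of Jacobi polynomials -/

theorem intervalIntegrable_one_sub_rpow {α : ℝ} (hα : -1 < α) :
    IntervalIntegrable (fun u : ℝ => (1 - u) ^ α) volume 0 1 := by
  have h := (intervalIntegral.intervalIntegrable_rpow' (a := 0) (b := 1) hα).comp_sub_left 1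
  simpa using h.symm

theorem intervalIntegrable_mul_one_sub_rpow {α : ℝ} (hα : -1 < α) {g : ℝ → ℝ}
    (hg : Continuous g) : IntervalIntegrable (fun u : ℝ => g u * (1 - u) ^ α) volume 0 1 :=
  (intervalIntegrable_one_sub_rpow hα).continuousOn_mul hg.continuousOn

theorem one_sub_pow_mul_rpow {α u : ℝ} (hα : -1 < α) (hu : u ≤ 1) (s : ℕ) :
    (1 - u) ^ s * (1 - u) ^ α = (1 - u) ^ (α + s) := by
  rcases hu.lt_or_eq with h | rfl
  · rw [Real.rpow_add_natCast (by linarith), mul_comm]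
  · cases s with
    | zero => simp
    | succ s =>
      have : α + ((s + 1 : ℕ) : ℝ) ≠ 0 := by
        have : (0 : ℝ) ≤ s := by positivity
        push_cast
        linarith
      rw [sub_self, Real.zero_rpow this, zero_pow s.succ_ne_zero, zero_mul]

/-- A Beta integral, by induction on `n` with `α` free: replacing one factor `u` by `1 - (1 - u)`
trades the power of `u` for a raised exponent `α + 1`. -/
theorem integral_pow_mul_one_sub_rpow {α : ℝ} (hα : -1 < α) (n : ℕ) :
    ∫ u in (0 : ℝ)..1, u ^ n * (1 - u) ^ α = n.factorial / rising (α + 1) (n + 1) := by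
  induction n generalizing α with
  | zero =>
    have h := intervalIntegral.integral_comp_sub_left (a := 0) (b := 1) (fun u : ℝ => u ^ α) 1
    simp only [pow_zero, one_mul]
    rw [h, integral_rpow (Or.inl hα)]
    simp [rising_succ, Real.zero_rpow (show α + 1 ≠ 0 by linarith)]
  | succ n ih =>
    have h1 : ∫ u in (0 : ℝ)..1, u ^ (n + 1) * (1 - u) ^ α
        = ∫ u in (0 : ℝ)..1, (u ^ n * (1 - u) ^ α - u ^ n * (1 - u) ^ (α + 1)) := by
      refine intervalIntegral.integral_congr fun u hu => ?_
      rw [Set.uIcc_of_le zero_le_one] at hu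
      have h := one_sub_pow_mul_rpow hα hu.2 1
      simp only [pow_one, Nat.cast_one] at h
      simp only [← h]
      ring
    rw [h1, intervalIntegral.integral_sub
      (intervalIntegrable_mul_one_sub_rpow hα (by fun_prop))
      (intervalIntegrable_mul_one_sub_rpow (by linarith) (by fun_prop)), ih hα,
      ih (by linarith)]
    have hx : 0 < α + 1 := by linarith
    rw [rising_succ_left (α + 1) (n + 1), rising_succ_left (α + 1) n, rising_succ (α + 1 + 1),
      Nat.factorial_succ]
    have := (rising_pos (a := α + 1 + 1) (by linarith) n).ne'
    have : α + 1 + 1 + n ≠ 0 := by positivity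
    push_cast
    field_simp
    ring

theorem continuous_jacobi (α β : ℝ) (l : ℕ) : Continuous (jacobi α β l) := by
  unfold jacobi
  fun_prop

/-- The defining expansion of the Jacobi polynomial is in powers of `1 - u`, which only raise the
exponent `α`; each term is a Beta integral. -/
theorem integral_jacobi_mul_pow {α : ℝ} (hα : -1 < α) (j l m : ℕ) :
    ∫ u in (0 : ℝ)..1, jacobi α j l (2 * u - 1) * u ^ (j + m) * (1 - u) ^ α
      = ∑ s ∈ Finset.range (l + 1), rising (α + 1 + s) (l - s) * rising (l + α + j + 1) s /
        ((s.factorial : ℝ) * ((l - s).factorial : ℝ)) *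
        ((-1) ^ s * ((j + m).factorial / rising (α + 1 + s) (j + m + 1))) := by
  have hs : ∀ s : ℕ, -1 < α + s := fun s => by
    have : (0 : ℝ) ≤ s := by positivity
    linarith
  have h1 : ∫ u in (0 : ℝ)..1, jacobi α j l (2 * u - 1) * u ^ (j + m) * (1 - u) ^ α
      = ∫ u in (0 : ℝ)..1, ∑ s ∈ Finset.range (l + 1),
        rising (α + 1 + s) (l - s) * rising (l + α + j + 1) s /
        ((s.factorial : ℝ) * ((l - s).factorial : ℝ)) *
        ((-1) ^ s * (u ^ (j + m) * (1 - u) ^ (α + s))) := by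
    refine intervalIntegral.integral_congr fun u hu => ?_
    rw [Set.uIcc_of_le zero_le_one] at hu
    simp only [jacobi, Finset.sum_mul]
    refine Finset.sum_congr rfl fun s _ => ?_
    rw [← one_sub_pow_mul_rpow hα hu.2 s,
      show (2 * u - 1 - 1) / 2 = (-1) * (1 - u) by ring, mul_pow]
    ring
  rw [h1, intervalIntegral.integral_finsetSum]
  · refine Finset.sum_congr rfl fun s _ => ?_
    rw [intervalIntegral.integral_const_mul, intervalIntegral.integral_const_mul,
      integral_pow_mul_one_sub_rpow (hs s), add_right_comm]
  · exact fun s _ => ((intervalIntegrable_mul_one_sub_rpow (hs s) (by fun_prop)).const_mul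
      _).const_mul _

/-- The squared norm of the Jacobi polynomial for the weight `(1-u)^α u^j` on `[0,1]`. -/
def jacobiNormSq (α : ℝ) (j l : ℕ) : ℝ :=
  rising (α + 1) l * (j + l).factorial /
    (rising (α + 1) (l + j) * l.factorial * (2 * l + j + α + 1))

theorem jacobiNormSq_pos {α : ℝ} (hα : -1 < α) (j l : ℕ) : 0 < jacobiNormSq α j l := by
  have hx : 0 < α + 1 := by linarith
  have h1 := rising_pos hx l
  have h2 := rising_pos hx (l + j)
  have h3 : 0 < 2 * (l : ℝ) + j + α + 1 := by
    rw [add_assoc _ α]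
    positivity
  unfold jacobiNormSq
  positivity

/-- The factor of lower degree is expanded in powers of `u`; the moments of order below `l` vanish,
so at most its leading term, when `l' = l`, contributes. -/
theorem integral_jacobi_mul_jacobi_of_le {α : ℝ} (hα : -1 < α) (j l l' : ℕ) (h : l' ≤ l) :
    ∫ u in (0 : ℝ)..1, jacobi α j l (2 * u - 1) * jacobi α j l' (2 * u - 1) * u ^ j *
      (1 - u) ^ α = if l = l' then jacobiNormSq α j l else 0 := by
  have h1 : ∫ u in (0 : ℝ)..1, jacobi α j l (2 * u - 1) * jacobi α j l' (2 * u - 1) * u ^ j *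
        (1 - u) ^ α
      = ∫ u in (0 : ℝ)..1, ∑ i ∈ Finset.range (l' + 1),
        (-1) ^ (l' - i) * rising (j + 1 + i) (l' - i) * rising (l' + α + j + 1) i /
        ((i.factorial : ℝ) * ((l' - i).factorial : ℝ)) *
        (jacobi α j l (2 * u - 1) * u ^ (j + i) * (1 - u) ^ α) := by
    congr 1
    ext u
    rw [jacobi_two_mul_sub_one α j l', Finset.mul_sum, Finset.sum_mul, Finset.sum_mul]
    refine Finset.sum_congr rfl fun s _ => ?_
    rw [pow_add]
    ring
  rw [h1, intervalIntegral.integral_finsetSum]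
  swap
  · have := continuous_jacobi α j l
    exact fun s _ => (intervalIntegrable_mul_one_sub_rpow hα (by fun_prop)).const_mul _
  simp only [intervalIntegral.integral_const_mul, integral_jacobi_mul_pow hα]
  rw [Finset.sum_range_succ, Finset.sum_eq_zero, zero_add]
  · split_ifs with hl
    · subst hl
      rw [jacobi_moment_self α hα, rising_succ]
      simp only [Nat.sub_self, pow_zero, rising_zero, Nat.factorial_zero, jacobiNormSq]
      have hc : 0 < l + α + j + 1 := by
        rw [show (l : ℝ) + α + j + 1 = l + j + (α + 1) by ring]
        have : 0 < α + 1 := by linarith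
        positivity
      have h2 := (rising_pos hc l).ne'
      have h3 := (rising_pos (show 0 < α + 1 by linarith) (l + j)).ne'
      have h4 : (l : ℝ) + α + j + 1 + l ≠ 0 := by positivity
      have h5 : 2 * (l : ℝ) + j + α + 1 = l + α + j + 1 + l := by ring
      rw [h5]
      push_cast
      field_simp
    · rw [jacobi_moment_eq_zero α hα j l l' (lt_of_le_of_ne h (Ne.symm hl)), mul_zero]
  · intro i hi
    rw [jacobi_moment_eq_zero α hα j l i (lt_of_lt_of_le (Finset.mem_range.1 hi) h), mul_zero]

theorem integral_jacobi_mul_jacobi {α : ℝ} (hα : -1 < α) (j l l' : ℕ) :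
    ∫ u in (0 : ℝ)..1, jacobi α j l (2 * u - 1) * jacobi α j l' (2 * u - 1) * u ^ j *
      (1 - u) ^ α = if l = l' then jacobiNormSq α j l else 0 := by
  rcases le_total l' l with h | h
  · exact integral_jacobi_mul_jacobi_of_le hα j l l' h
  · have := integral_jacobi_mul_jacobi_of_le hα j l' l h
    simp only [mul_comm (jacobi α j l' _)] at this
    rw [this]
    by_cases e : l = l'
    · simp [e]
    · simp [e, Ne.symm e]

theorem integral_jacobi_sq_mul_jacobiWeight {α : ℝ} (hα : -1 < α) (j l : ℕ) :
    ∫ u in (-1 : ℝ)..1, jacobi α j l u ^ 2 * jacobiWeight α j u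
      = 2 * (2 ^ α * 2 ^ j) * jacobiNormSq α j l := by
  have h := intervalIntegral.integral_comp_mul_sub (a := 0) (b := 1)
    (fun u : ℝ => jacobi α j l u ^ 2 * jacobiWeight α j u) (c := 2) two_ne_zero 1
  have h' := integral_jacobi_mul_jacobi hα j l l
  norm_num at h
  rw [if_pos rfl] at h'
  have e : ∫ u in (-1 : ℝ)..1, jacobi α j l u ^ 2 * jacobiWeight α j u
      = 2 * ∫ u in (0 : ℝ)..1, jacobi α j l (2 * u - 1) ^ 2 * jacobiWeight α j (2 * u - 1) := by
    rw [h]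
    ring
  rw [e, mul_assoc, ← h', ← intervalIntegral.integral_const_mul (2 ^ α * 2 ^ j : ℝ)]
  congr 1
  refine intervalIntegral.integral_congr fun u hu => ?_
  rw [Set.uIcc_of_le zero_le_one] at hu
  simp only [jacobiWeight]
  rw [show 1 - (2 * u - 1) = 2 * (1 - u) by ring, show 1 + (2 * u - 1) = 2 * u by ring,
    Real.mul_rpow zero_le_two (by linarith [hu.2]), Real.rpow_natCast, mul_pow]
  ring

/-- The value of the normalizing constant is never needed, because it cancels in `λ_{l,k} P P`; only
its positivity matters. The integral of the weight is the case `l = 0` of the norm formula. -/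
theorem exists_jacobiON_eq {α : ℝ} (hα : -1 < α) (j l : ℕ) :
    ∃ c : ℝ, 0 < c ∧ ∀ t, jacobiON α j l t = jacobi α j l t / c := by
  refine ⟨_, ?_, fun t => rfl⟩
  have h1 := integral_jacobi_sq_mul_jacobiWeight hα j l
  have h0 := integral_jacobi_sq_mul_jacobiWeight hα j 0
  have e : ∀ u, jacobi α j 0 u = 1 := fun u => by simp [jacobi]
  simp only [e, one_pow, one_mul] at h0
  rw [h1, h0]
  have := jacobiNormSq_pos hα j l
  have := jacobiNormSq_pos hα j 0
  positivity

/-! ### Integrals over the disk -/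

theorem measurableSet_disk : MeasurableSet disk :=
  measurableSet_le (by fun_prop) measurable_const

theorem measurable_weight (μ : ℝ) : Measurable (weight μ) := by
  unfold weight
  fun_prop

theorem weight_nonneg (μ : ℝ) {p : ℝ × ℝ} (hp : p ∈ disk) : 0 ≤ weight μ p :=
  Real.rpow_nonneg (by have : p.1 ^ 2 + p.2 ^ 2 ≤ 1 := hp; linarith) _

theorem aConst_pos {μ : ℝ} (hμ : 0 ≤ μ) : 0 < aConst μ :=
  div_pos (by linarith) Real.pi_pos

theorem integral_diskMeasure {μ : ℝ} (hμ : 0 ≤ μ) (F : ℝ × ℝ → ℝ) :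
    ∫ p, F p ∂(diskMeasure μ) = ∫ p in disk, aConst μ * weight μ p * F p := by
  unfold diskMeasure
  rw [integral_withDensity_eq_integral_toReal_smul]
  · refine setIntegral_congr_fun measurableSet_disk fun p hp => ?_
    simp only [smul_eq_mul]
    rw [ENNReal.toReal_ofReal (mul_nonneg (aConst_pos hμ).le (weight_nonneg μ hp))]
  · exact ((measurable_weight μ).const_mul _).ennreal_ofReal
  · exact Eventually.of_forall fun _ => ENNReal.ofReal_lt_top

theorem integral_disk_polar (μ : ℝ) {F : ℝ × ℝ → ℝ} {G T : ℝ → ℝ}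
    (hF : ∀ r φ, F (r * Real.cos φ, r * Real.sin φ) = G r * T φ) :
    ∫ p in disk, aConst μ * weight μ p * F p
      = aConst μ * (∫ r in Set.Ioc (0 : ℝ) 1, r * ((1 - r ^ 2) ^ (μ - 1 / 2) * G r)) *
        ∫ φ in (-Real.pi)..Real.pi, T φ := by
  rw [← integral_indicator measurableSet_disk, ← integral_comp_polarCoord_symm,
    polarCoord_target]
  have h1 : ∀ p ∈ Set.Ioi (0 : ℝ) ×ˢ Set.Ioo (-Real.pi) Real.pi,
      p.1 • disk.indicator (fun p => aConst μ * weight μ p * F p) (polarCoord.symm p)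
      = (Set.Ioc (0 : ℝ) 1).indicator
          (fun r => aConst μ * (r * ((1 - r ^ 2) ^ (μ - 1 / 2) * G r))) p.1 * T p.2 := by
    rintro ⟨r, φ⟩ ⟨hr, -⟩
    have hr : 0 < r := hr
    have hsq : (r * Real.cos φ) ^ 2 + (r * Real.sin φ) ^ 2 = r ^ 2 := by
      have := Real.sin_sq_add_cos_sq φ
      linear_combination r ^ 2 * this
    have hmem : polarCoord.symm (r, φ) ∈ disk ↔ r ∈ Set.Ioc (0 : ℝ) 1 := by
      simp only [polarCoord_symm_apply, disk, Set.mem_ofPred_eq, hsq, Set.mem_Ioc, hr, true_and]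
      exact sq_le_one_iff₀ hr.le
    by_cases h : r ∈ Set.Ioc (0 : ℝ) 1
    · rw [Set.indicator_of_mem (hmem.2 h), Set.indicator_of_mem h]
      simp only [polarCoord_symm_apply, hF, weight, smul_eq_mul]
      rw [sub_sub, hsq]
      ring
    · rw [Set.indicator_of_notMem (fun h' => h (hmem.1 h')), Set.indicator_of_notMem h]
      simp
  rw [setIntegral_congr_fun (measurableSet_Ioi.prod measurableSet_Ioo) h1,
    Measure.volume_eq_prod, setIntegral_prod_mul, setIntegral_indicator measurableSet_Ioc,
    Set.inter_eq_right.2 (fun x hx => hx.1), integral_const_mul,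
    intervalIntegral.integral_of_le (by linarith [Real.pi_pos]), integral_Ioc_eq_integral_Ioo,
    integral_Ioc_eq_integral_Ioo]

/-- The substitution `u = r²` turns radial integrals into Jacobi integrals on `[0,1]`. -/
theorem integral_mul_comp_sq (h : ℝ → ℝ) :
    ∫ r in Set.Ioc (0 : ℝ) 1, r * h (r ^ 2) = 1 / 2 * ∫ u in (0 : ℝ)..1, h u := by
  have himg : (fun r : ℝ => r ^ 2) '' Set.Ioo 0 1 = Set.Ioo 0 1 := by
    ext u
    constructor
    · rintro ⟨r, ⟨h0, h1⟩, rfl⟩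
      exact ⟨by positivity, by nlinarith⟩
    · rintro ⟨h0, h1⟩
      exact ⟨√u, ⟨Real.sqrt_pos.2 h0, by
        rw [Real.sqrt_lt' one_pos]; simpa using h1⟩, Real.sq_sqrt h0.le⟩
  have hc := integral_image_eq_integral_abs_deriv_smul (s := Set.Ioo (0 : ℝ) 1)
    (f := fun r => r ^ 2) (f' := fun r => 2 * r) measurableSet_Ioo
    (fun r _ => by simpa using (hasDerivAt_pow 2 r).hasDerivWithinAt)
    (fun r hr s hs hrs => by
      have : r ^ 2 = s ^ 2 := hrs
      exact (pow_left_inj₀ hr.1.le hs.1.le two_ne_zero).1 this) h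
  rw [himg] at hc
  rw [intervalIntegral.integral_of_le zero_le_one, integral_Ioc_eq_integral_Ioo,
    integral_Ioc_eq_integral_Ioo, hc, ← integral_const_mul]
  refine setIntegral_congr_fun measurableSet_Ioo fun r hr => ?_
  simp only [smul_eq_mul]
  rw [abs_of_pos (by linarith [hr.1])]
  ring

theorem isFiniteMeasure_diskMeasure {μ : ℝ} (hμ : 0 ≤ μ) : IsFiniteMeasure (diskMeasure μ) := by
  have h1 : ∫ p in disk, aConst μ * weight μ p * (fun _ => (1 : ℝ)) p = 1 := by
    rw [integral_disk_polar μ (G := fun _ => 1) (T := fun _ => 1) (fun _ _ => by simp),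
      integral_mul_comp_sq (fun u => (1 - u) ^ (μ - 1 / 2) * 1)]
    have h := integral_pow_mul_one_sub_rpow (α := μ - 1 / 2) (by linarith) 0
    simp only [pow_zero, one_mul] at h
    simp only [mul_one, h]
    simp only [Nat.factorial_zero, rising_succ, rising_zero, aConst, intervalIntegral.integral_const]
    have : μ - 1 / 2 + 1 = μ + 1 / 2 := by ring
    have : μ + 1 / 2 ≠ 0 := by positivity
    simp only [smul_eq_mul]
    push_cast
    rw [show μ - 1 / 2 + 1 + 0 = μ + 1 / 2 by ring]
    field_simp
    ring
  have h2 : Integrable (fun p => aConst μ * weight μ p) (volume.restrict disk) := by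
    -- The Bochner integral of a non-integrable function is zero by definition, so the computed
    -- total mass `1` already proves integrability.
    by_contra h
    rw [integral_undef (by simpa using h)] at h1
    exact zero_ne_one h1
  exact isFiniteMeasure_withDensity_ofReal h2.2

theorem integral_cos_intCast_mul (n : ℤ) :
    ∫ φ in (-Real.pi)..Real.pi, Real.cos (n * φ) = if n = 0 then 2 * Real.pi else 0 := by
  split_ifs with h
  · simp [h]
    ring
  · rw [intervalIntegral.integral_comp_mul_left _ (Int.cast_ne_zero.2 h), integral_cos]
    simp [Real.sin_int_mul_pi]

theorem integral_sin_intCast_mul (n : ℤ) :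
    ∫ φ in (-Real.pi)..Real.pi, Real.sin (n * φ) = 0 := by
  by_cases h : n = 0
  · simp [h]
  · rw [intervalIntegral.integral_comp_mul_left _ (Int.cast_ne_zero.2 h), integral_sin]
    simp

/-- The integral of `S_{j,ε}²` over a period. -/
def trigNormSq (j : ℕ) (ε : Fin 2) : ℝ :=
  if j = 0 then (if ε = 0 then 2 * Real.pi else 0) else Real.pi

theorem integral_trig_mul_trig (j j' : ℕ) (ε ε' : Fin 2) :
    ∫ φ in (-Real.pi)..Real.pi, trig j ε φ * trig j' ε' φ
      = if j = j' ∧ ε = ε' then trigNormSq j ε else 0 := by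
  have hA := integral_cos_intCast_mul (j - j')
  have hB := integral_cos_intCast_mul (j + j')
  have hC := integral_sin_intCast_mul (j - j')
  have hD := integral_sin_intCast_mul (j + j')
  have iA : ∀ n : ℤ, IntervalIntegrable (fun φ => Real.cos (n * φ)) volume (-Real.pi) Real.pi :=
    fun n => (by fun_prop : Continuous _).intervalIntegrable _ _
  have iB : ∀ n : ℤ, IntervalIntegrable (fun φ => Real.sin (n * φ)) volume (-Real.pi) Real.pi :=
    fun n => (by fun_prop : Continuous _).intervalIntegrable _ _
  have eA : ∀ φ : ℝ, Real.cos (((j - j' : ℤ) : ℝ) * φ) =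
      Real.cos (j * φ) * Real.cos (j' * φ) + Real.sin (j * φ) * Real.sin (j' * φ) := fun φ => by
    rw [← Real.cos_sub]; push_cast; ring_nf
  have eB : ∀ φ : ℝ, Real.cos (((j + j' : ℤ) : ℝ) * φ) =
      Real.cos (j * φ) * Real.cos (j' * φ) - Real.sin (j * φ) * Real.sin (j' * φ) := fun φ => by
    rw [← Real.cos_add]; push_cast; ring_nf
  have eC : ∀ φ : ℝ, Real.sin (((j - j' : ℤ) : ℝ) * φ) =
      Real.sin (j * φ) * Real.cos (j' * φ) - Real.cos (j * φ) * Real.sin (j' * φ) := fun φ => by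
    rw [← Real.sin_sub]; push_cast; ring_nf
  have eD : ∀ φ : ℝ, Real.sin (((j + j' : ℤ) : ℝ) * φ) =
      Real.sin (j * φ) * Real.cos (j' * φ) + Real.cos (j * φ) * Real.sin (j' * φ) := fun φ => by
    rw [← Real.sin_add]; push_cast; ring_nf
  have z1 : ((j : ℤ) - j' = 0) ↔ j = j' := by omega
  have z2 : ((j : ℤ) + j' = 0) ↔ j = 0 ∧ j' = 0 := by omega
  simp only [z1] at hA
  simp only [z2] at hB
  unfold trig trigNormSq
  fin_cases ε <;> fin_cases ε'
  · have h : ∀ φ : ℝ, Real.cos (j * φ) * Real.cos (j' * φ) = 1 / 2 *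
      (Real.cos (((j - j' : ℤ) : ℝ) * φ) + Real.cos (((j + j' : ℤ) : ℝ) * φ)) := fun φ => by
      rw [eA, eB]; ring
    simp only [Fin.zero_eta, Fin.isValue, if_true, h, and_true]
    rw [intervalIntegral.integral_const_mul, intervalIntegral.integral_add (iA _) (iA _), hA, hB]
    split_ifs <;> first | omega | ring
  · have h : ∀ φ : ℝ, Real.cos (j * φ) * Real.sin (j' * φ) = 1 / 2 *
      (Real.sin (((j + j' : ℤ) : ℝ) * φ) - Real.sin (((j - j' : ℤ) : ℝ) * φ)) := fun φ => by
      rw [eC, eD]; ring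
    simp [h]
    rw [intervalIntegral.integral_sub (by simpa using iB (j + j')) (by simpa using iB (j - j'))]
    simp at hC hD
    simp [hC, hD]
  · have h : ∀ φ : ℝ, Real.sin (j * φ) * Real.cos (j' * φ) = 1 / 2 *
      (Real.sin (((j + j' : ℤ) : ℝ) * φ) + Real.sin (((j - j' : ℤ) : ℝ) * φ)) := fun φ => by
      rw [eC, eD]; ring
    simp [h]
    rw [intervalIntegral.integral_add (by simpa using iB (j + j')) (by simpa using iB (j - j'))]
    simp at hC hD
    simp [hC, hD]
  · have h : ∀ φ : ℝ, Real.sin (j * φ) * Real.sin (j' * φ) = 1 / 2 *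
      (Real.cos (((j - j' : ℤ) : ℝ) * φ) - Real.cos (((j + j' : ℤ) : ℝ) * φ)) := fun φ => by
      rw [eA, eB]; ring
    simp only [Fin.mk_one, Fin.isValue, one_ne_zero, if_false, h, and_true]
    rw [intervalIntegral.integral_const_mul, intervalIntegral.integral_sub (iA _) (iA _), hA, hB]
    split_ifs <;> first | omega | ring

/-- The polynomial `P_l^(μ-1/2,k-2l)(2r²-1) r^(k-2l) S_{k-2l,ε}(φ)`. -/
def zernike (μ : ℝ) (k l : ℕ) (ε : Fin 2) (p : ℝ × ℝ) : ℝ :=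
  jacobi (μ - 1 / 2) (k - 2 * l : ℕ) l (2 * (p.1 ^ 2 + p.2 ^ 2) - 1) * solid (k - 2 * l) ε p

/-- The angular integral separates different frequencies `k - 2l` and different `ε`. At equal
frequency both radial factors belong to the same Jacobi weight, whose orthogonality separates `l`;
equal `l` and equal frequency force equal `k`. -/
theorem integral_zernike_mul_zernike {μ : ℝ} (hμ : 0 ≤ μ) {k l k' l' : ℕ} (hl : 2 * l ≤ k)
    (hl' : 2 * l' ≤ k') (ε ε' : Fin 2) :
    ∫ p, zernike μ k l ε p * zernike μ k' l' ε' p ∂(diskMeasure μ)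
      = if k = k' ∧ l = l' ∧ ε = ε' then
          aConst μ * (1 / 2 * jacobiNormSq (μ - 1 / 2) (k - 2 * l) l) * trigNormSq (k - 2 * l) ε
        else 0 := by
  rw [integral_diskMeasure hμ, integral_disk_polar μ
    (G := fun r => jacobi (μ - 1 / 2) (k - 2 * l : ℕ) l (2 * r ^ 2 - 1) *
      jacobi (μ - 1 / 2) (k' - 2 * l' : ℕ) l' (2 * r ^ 2 - 1) *
      r ^ (k - 2 * l) * r ^ (k' - 2 * l'))
    (T := fun φ => trig (k - 2 * l) ε φ * trig (k' - 2 * l') ε' φ), integral_trig_mul_trig]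
  · by_cases h : k - 2 * l = k' - 2 * l'
    · have hr := integral_mul_comp_sq (fun u => (1 - u) ^ (μ - 1 / 2) *
        (jacobi (μ - 1 / 2) (k - 2 * l : ℕ) l (2 * u - 1) *
        jacobi (μ - 1 / 2) (k - 2 * l : ℕ) l' (2 * u - 1) * u ^ (k - 2 * l)))
      have hr' := integral_jacobi_mul_jacobi (α := μ - 1 / 2) (by linarith) (k - 2 * l) l l'
      simp only [mul_comm ((1 - _ : ℝ) ^ (μ - 1 / 2))] at hr ⊢
      rw [hr'] at hr
      simp only [← h]
      simp only [← pow_mul, two_mul (k - 2 * l), pow_add, ← mul_assoc] at hr ⊢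
      rw [hr]
      by_cases h2 : l = l'
      · have : k = k' := by omega
        simp [h2, this, mul_assoc]
      · simp [h2]
    · have : ¬ (k = k' ∧ l = l' ∧ ε = ε') := fun h' => h (by rw [h'.1, h'.2.1])
      simp [h, this]
  · intro r φ
    have hsq : (r * Real.cos φ) ^ 2 + (r * Real.sin φ) ^ 2 = r ^ 2 := by
      have := Real.sin_sq_add_cos_sq φ
      linear_combination r ^ 2 * this
    simp only [zernike, solid_polar, hsq]
    ring

/-! ### The Fourier expansion of Gegenbauer polynomials -/

/-- Pairs `l` with `k - l`, so that conjugate monomials meet; the middle index, if any, is counted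
once. -/
theorem sum_range_eq_sum_fold {M : Type*} [AddCommMonoid M] (k : ℕ) (g : ℕ → M) :
    ∑ b ∈ Finset.range (k + 1), g b
      = ∑ l ∈ Finset.range (k + 1) with 2 * l ≤ k, g l
        + ∑ l ∈ Finset.range (k + 1) with 2 * l < k, g (k - l) := by
  rw [← Finset.sum_filter_add_sum_filter_not _ (fun b => 2 * b ≤ k)]
  congr 1
  refine Finset.sum_nbij' (fun b => k - b) (fun l => k - l) ?_ ?_ ?_ ?_ ?_ <;>
    simp only [Finset.mem_filter, Finset.mem_range] <;> intro b hb
  · omega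
  · omega
  · omega
  · omega
  · congr 1
    omega

/-- Each power is expanded by the binomial theorem and the monomials are collected by the difference
of their exponents, which is `± (k - 2l)`; what is left is a polynomial in `w w'`. -/
theorem sum_mul_add_pow (k : ℕ) (c : ℕ → ℂ) (w w' : ℂ) :
    ∑ i ∈ Finset.range (k / 2 + 1), c i * (w + w') ^ (k - 2 * i)
      = ∑ l ∈ Finset.range (k + 1) with 2 * l ≤ k, ∑ i ∈ Finset.range (l + 1),
          c i * (k - 2 * i).choose (l - i) * (w * w') ^ (l - i) * w' ^ (k - 2 * l)
        + ∑ l ∈ Finset.range (k + 1) with 2 * l < k, ∑ i ∈ Finset.range (l + 1),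
          c i * (k - 2 * i).choose (l - i) * (w * w') ^ (l - i) * w ^ (k - 2 * l) := by
  have h1 : ∑ i ∈ Finset.range (k / 2 + 1), c i * (w + w') ^ (k - 2 * i)
      = ∑ i ∈ Finset.range (k / 2 + 1), ∑ b ∈ Finset.Ico i (k - i + 1),
        c i * (k - 2 * i).choose (b - i) * w ^ (b - i) * w' ^ (k - i - b) := by
    refine Finset.sum_congr rfl fun i hi => ?_
    rw [Finset.mem_range] at hi
    rw [Finset.sum_Ico_eq_sum_range, show k - i + 1 - i = k - 2 * i + 1 by omega, add_pow,
      Finset.mul_sum]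
    refine Finset.sum_congr rfl fun a _ => ?_
    rw [Nat.add_sub_cancel_left, show k - i - (i + a) = k - 2 * i - a by omega]
    ring
  -- For fixed `b`, the conditions on `i` amount to `i ≤ b` and `i ≤ k - b`.
  rw [h1, Finset.sum_comm' (t' := Finset.range (k + 1))
    (s' := fun b => Finset.range (min b (k - b) + 1)), sum_range_eq_sum_fold]
  · congr 1
    · refine Finset.sum_congr rfl fun l hl => ?_
      rw [Finset.mem_filter] at hl
      rw [min_eq_left (by omega)]
      refine Finset.sum_congr rfl fun i hi => ?_
      rw [Finset.mem_range] at hi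
      rw [show k - i - l = (l - i) + (k - 2 * l) by omega, pow_add, mul_pow]
      ring
    · refine Finset.sum_congr rfl fun l hl => ?_
      rw [Finset.mem_filter] at hl
      rw [show min (k - l) (k - (k - l)) = l by omega]
      refine Finset.sum_congr rfl fun i hi => ?_
      rw [Finset.mem_range] at hi
      rw [show k - l - i = (k - 2 * i) - (l - i) by omega, Nat.choose_symm (by omega),
        show (k - 2 * i) - (l - i) = (l - i) + (k - 2 * l) by omega,
        show k - i - (k - l) = l - i by omega, pow_add, mul_pow]
      ring
  · intro i b
    simp only [Finset.mem_range, Finset.mem_Ico]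
    omega

/-- Read in reverse order, `i = l - s`, the terms match the expansion of the Jacobi polynomial at
`-1`. This is where the parameters `(μ - 1/2, k - 2l)` come from. -/
theorem sum_gegenbauer_coeff (α : ℝ) (k l : ℕ) (hl : 2 * l ≤ k) (u : ℝ) :
    ∑ i ∈ Finset.range (l + 1), (-1) ^ i * rising (α + 1) (k - i) /
        ((i.factorial : ℝ) * ((k - 2 * i).factorial : ℝ)) * (k - 2 * i).choose (l - i) * u ^ (l - i)
      = rising (α + 1) (k - l) / (k - l).factorial *
        jacobi α (k - 2 * l : ℕ) l (2 * u - 1) := by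
  obtain ⟨j, rfl⟩ := Nat.exists_eq_add_of_le hl
  rw [← Finset.sum_range_reflect, jacobi_two_mul_sub_one, Finset.mul_sum]
  refine Finset.sum_congr rfl fun s hs => ?_
  have hs' : s ≤ l := Nat.lt_succ_iff.1 (Finset.mem_range.1 hs)
  obtain ⟨r, rfl⟩ := Nat.exists_eq_add_of_le hs'
  have e2 : 2 * (s + r) + j - r = (s + r + j) + s := by omega
  have e3 : 2 * (s + r) + j - 2 * r = s + (j + s) := by omega
  have e4 : 2 * (s + r) + j - (s + r) = s + r + j := by omega
  have e5 : 2 * (s + r) + j - 2 * (s + r) = j := by omega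
  simp only [e2, e3, e4, e5, Nat.add_sub_cancel_left, Nat.add_sub_cancel]
  rw [rising_add, Nat.cast_choose ℝ (Nat.le_add_right _ _), Nat.add_sub_cancel_left]
  have h := rising_natCast_add_one (j + s) r
  push_cast at h
  rw [show (j : ℝ) + 1 + s = j + s + 1 by ring, h, show j + s + r = s + r + j by ring]
  push_cast
  rw [show (s : ℝ) + r + α + j + 1 = α + 1 + (s + r + j) by ring]
  field_simp

theorem ofReal_solid_zero_mul_two (j : ℕ) (p : ℝ × ℝ) :
    (2 * solid j 0 p : ℂ) = (⟨p.1, p.2⟩ : ℂ) ^ j + (starRingEnd ℂ ⟨p.1, p.2⟩) ^ j := by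
  rw [← map_pow, Complex.add_conj]
  simp [solid]

/-- The factor `2` for positive frequencies. -/
def freqFactor (k l : ℕ) : ℝ := if 2 * l < k then 2 else 1

@[simp] theorem solid_zero_zero (p : ℝ × ℝ) : solid 0 0 p = 1 := by simp [solid]

@[simp] theorem solid_zero_one (p : ℝ × ℝ) : solid 0 1 p = 0 := by simp [solid]

/-- The Gegenbauer polynomial of `x` as a combination of disk polynomials of `(x, y)`. -/
theorem gegenbauer_eq_sum_zernike (μ : ℝ) (k : ℕ) (p : ℝ × ℝ) :
    gegenbauer (μ + 1 / 2) k p.1 = ∑ l ∈ Finset.range (k + 1) with 2 * l ≤ k,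
      freqFactor k l * (rising (μ + 1 / 2) (k - l) / (k - l).factorial) * zernike μ k l 0 p := by
  have hμ : μ + 1 / 2 = (μ - 1 / 2) + 1 := by ring
  have hS : ∀ l, 2 * l ≤ k → ((rising (μ + 1 / 2) (k - l) / (k - l).factorial *
        jacobi (μ - 1 / 2) (k - 2 * l : ℕ) l (2 * (p.1 ^ 2 + p.2 ^ 2) - 1) : ℝ) : ℂ)
      = ∑ i ∈ Finset.range (l + 1), (((-1) ^ i * rising (μ + 1 / 2) (k - i) /
        ((i.factorial : ℝ) * ((k - 2 * i).factorial : ℝ)) : ℝ) : ℂ) * (k - 2 * i).choose (l - i) *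
        ((⟨p.1, p.2⟩ : ℂ) * starRingEnd ℂ ⟨p.1, p.2⟩) ^ (l - i) := by
    intro l hl
    rw [hμ, ← sum_gegenbauer_coeff _ k l hl, Complex.mul_conj, Complex.normSq_mk]
    push_cast
    simp only [sq]
  -- Here `2x = w + w̄` with `w = x + iy`; the product `w w̄ = x² + y²` is the argument `u` in `hS`.
  -- The two halves produced by `sum_mul_add_pow` then combine to `w^j + w̄^j`, twice a real part,
  -- except at `2l = k`, where only the first half is present.
  have h1 : ((gegenbauer (μ + 1 / 2) k p.1 : ℝ) : ℂ) = ∑ i ∈ Finset.range (k / 2 + 1),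
      (((-1) ^ i * rising (μ + 1 / 2) (k - i) /
        ((i.factorial : ℝ) * ((k - 2 * i).factorial : ℝ)) : ℝ) : ℂ) *
      ((⟨p.1, p.2⟩ : ℂ) + starRingEnd ℂ ⟨p.1, p.2⟩) ^ (k - 2 * i) := by
    rw [Complex.add_conj]
    simp only [gegenbauer]
    push_cast
    rfl
  rw [sum_mul_add_pow] at h1
  simp only [← Finset.sum_mul] at h1
  have e : Finset.filter (fun l => 2 * l < k) (Finset.range (k + 1))
      = Finset.filter (fun l => 2 * l < k)
        (Finset.filter (fun l => 2 * l ≤ k) (Finset.range (k + 1))) := by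
    ext l
    simp only [Finset.mem_filter]
    constructor
    · exact fun h => ⟨⟨h.1, h.2.le⟩, h.2⟩
    · exact fun h => ⟨h.1.1, h.2⟩
  rw [e, Finset.sum_filter (fun l => 2 * l < k), ← Finset.sum_add_distrib] at h1
  rw [← Complex.ofReal_inj, h1, Complex.ofReal_sum]
  refine Finset.sum_congr rfl fun l hl => ?_
  have hl' : 2 * l ≤ k := (Finset.mem_filter.1 hl).2
  rw [← hS l hl']
  unfold zernike freqFactor
  split_ifs with h
  · have := ofReal_solid_zero_mul_two (k - 2 * l) p
    rw [← mul_add, add_comm (starRingEnd ℂ _ ^ _), ← this]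
    push_cast
    ring
  · have : k - 2 * l = 0 := by omega
    simp [this]

/-! ### The kernel `D_k` -/

theorem rotate_solid_zero (j : ℕ) (ξ : ℝ) (p : ℝ × ℝ) :
    solid j 0 (p.1 * Real.cos ξ + p.2 * Real.sin ξ, p.2 * Real.cos ξ - p.1 * Real.sin ξ)
      = Real.cos (j * ξ) * solid j 0 p + Real.sin (j * ξ) * solid j 1 p := by
  have h1 : (⟨p.1 * Real.cos ξ + p.2 * Real.sin ξ, p.2 * Real.cos ξ - p.1 * Real.sin ξ⟩ : ℂ)
      = (⟨Real.cos (-ξ), Real.sin (-ξ)⟩ : ℂ) * ⟨p.1, p.2⟩ := by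
    apply Complex.ext <;> simp <;> ring
  have h2 : (⟨Real.cos (-ξ), Real.sin (-ξ)⟩ : ℂ) ^ j
      = ⟨Real.cos (j * ξ), -Real.sin (j * ξ)⟩ := by
    have e0 := solid_polar j 0 1 (-ξ)
    have e1 := solid_polar j 1 1 (-ξ)
    simp only [solid, trig, one_mul, one_pow, if_true, one_ne_zero, if_false, mul_neg,
      Real.cos_neg (j * ξ), Real.sin_neg (j * ξ)] at e0 e1
    exact Complex.ext e0 e1
  simp only [solid, h1, mul_pow, h2, if_true, one_ne_zero, if_false, Complex.mul_re]
  ring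

/-- The rotation by `-ξ` moves `⟨p, ξ⟩` into the first coordinate, where `gegenbauer_eq_sum_zernike`
applies; it fixes the radius and multiplies `(x + iy)^j` by `e^(-ijξ)`. -/
theorem zernike_rotate (μ : ℝ) (k l : ℕ) (ξ : ℝ) (p : ℝ × ℝ) :
    zernike μ k l 0 (p.1 * Real.cos ξ + p.2 * Real.sin ξ, p.2 * Real.cos ξ - p.1 * Real.sin ξ)
      = Real.cos ((k - 2 * l : ℕ) * ξ) * zernike μ k l 0 p +
        Real.sin ((k - 2 * l : ℕ) * ξ) * zernike μ k l 1 p := by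
  have hsq : (p.1 * Real.cos ξ + p.2 * Real.sin ξ) ^ 2 + (p.2 * Real.cos ξ - p.1 * Real.sin ξ) ^ 2
      = p.1 ^ 2 + p.2 ^ 2 := by
    have := Real.sin_sq_add_cos_sq ξ
    linear_combination (p.1 ^ 2 + p.2 ^ 2) * this
  simp only [zernike, rotate_solid_zero, hsq]
  ring

/-- Both `h_{l,k}` and the Jacobi normalization occur squared in the product and in `λ_{l,k}⁻¹`,
hence cancel. On the unit circle the Jacobi argument is `1`, so one factor `P_l(1)` remains in the
denominator. -/
theorem lambdaConst_mul_basisFn {μ : ℝ} (hμ : 0 ≤ μ) (k l : ℕ) (ε : Fin 2) (ξ : ℝ)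
    (p : ℝ × ℝ) :
    lambdaConst μ l k * basisFn μ k l ε (Real.cos ξ, Real.sin ξ) * basisFn μ k l ε p
      = freqFactor k l * (l.factorial / rising (μ + 1 / 2) l) *
        (trig (k - 2 * l) ε ξ * zernike μ k l ε p) := by
  obtain ⟨c, hc, h⟩ := exists_jacobiON_eq (α := μ - 1 / 2) (by linarith) (k - 2 * l) l
  have hh : hConst μ l k ≠ 0 := by
    refine (Real.sqrt_pos.2 (div_pos (Real.Gamma_pos_of_pos ?_)
      (mul_pos (Real.Gamma_pos_of_pos ?_) (Real.Gamma_pos_of_pos ?_)))).ne' <;> positivity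
  have hs : solid (k - 2 * l) ε (Real.cos ξ, Real.sin ξ) = trig (k - 2 * l) ε ξ := by
    simpa using solid_polar (k - 2 * l) ε 1 ξ
  have h2 : (if 2 * l < k then √2 else 1 : ℝ) ^ 2 = freqFactor k l := by
    unfold freqFactor
    split_ifs <;> simp
  have hr := (rising_pos (a := μ + 1 / 2) (by linarith) l).ne'
  unfold lambdaConst HConst basisFn zernike
  rw [← h2, hs, h, h, h, Real.cos_sq_add_sin_sq, show (2 * 1 - 1 : ℝ) = 1 by norm_num,
    jacobi_one, show μ - 1 / 2 + 1 = μ + 1 / 2 by ring]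
  field_simp

theorem dKernel_eq {μ : ℝ} (hμ : 0 ≤ μ) (k : ℕ) (ξ : ℝ) (p : ℝ × ℝ) :
    dKernel μ k ξ p = ∑ l ∈ Finset.range (k + 1) with 2 * l ≤ k,
      freqFactor k l * (l.factorial / rising (μ + 1 / 2) l) *
        (Real.cos ((k - 2 * l : ℕ) * ξ) * zernike μ k l 0 p +
          Real.sin ((k - 2 * l : ℕ) * ξ) * zernike μ k l 1 p) := by
  unfold dKernel
  simp only [lambdaConst_mul_basisFn hμ, mul_add, Finset.sum_add_distrib]
  congr 1
  -- The sine sum may be extended to `2l = k`, where the added term is zero.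
  refine Finset.sum_subset (fun l hl => ?_) fun l hl hl' => ?_
  · rw [Finset.mem_filter] at hl ⊢
    exact ⟨hl.1, hl.2.le⟩
  · rw [Finset.mem_filter] at hl hl'
    have h : ¬ 2 * l < k := fun h => hl' ⟨hl.1, h⟩
    have : k - 2 * l = 0 := by omega
    simp [zernike, this]

/-! ### The reproducing kernel as a mean over directions -/

/-- Equal weights at the angles `θ_ν`, `ν < N`, integrate the functions `cos 2iθ`, `sin 2iθ`
with `|i| ≤ n` exactly. -/
def IsQuadrature (n N : ℕ) (θ : ℕ → ℝ) : Prop :=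
  ∀ i : ℤ, i ≠ 0 → |i| ≤ n → ∑ ν ∈ Finset.range N, Real.cos (2 * i * θ ν) = 0 ∧
    ∑ ν ∈ Finset.range N, Real.sin (2 * i * θ ν) = 0

/-- Frequencies `k - 2l` and `k - 2l'` have the same parity, so their difference and sum are the
even numbers `2(l' - l)` and `2(k - l - l')`, with halves at most `n` in size. Only frequency zero
survives the sum. `freqFactor` compensates the mean `1/2` of `cos²` and `sin²`; at frequency zero
the sine term is lost, hence the condition on `b`. -/
theorem IsQuadrature.sum_mul {n N : ℕ} {θ : ℕ → ℝ} (h : IsQuadrature n N θ) {k : ℕ}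
    (hk : k ≤ n) {l l' : ℕ} (hl : 2 * l ≤ k) (hl' : 2 * l' ≤ k) (a b a' b' : ℝ)
    (hb : 2 * l = k → b = 0) :
    freqFactor k l * ∑ ν ∈ Finset.range N,
      (Real.cos ((k - 2 * l : ℕ) * θ ν) * a + Real.sin ((k - 2 * l : ℕ) * θ ν) * b) *
      (Real.cos ((k - 2 * l' : ℕ) * θ ν) * a' + Real.sin ((k - 2 * l' : ℕ) * θ ν) * b')
      = if l = l' then N * (a * a' + b * b') else 0 := by
  have e1 : ∀ φ : ℝ, Real.cos (2 * ((l' : ℤ) - l : ℤ) * φ) =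
      Real.cos ((k - 2 * l : ℕ) * φ) * Real.cos ((k - 2 * l' : ℕ) * φ) +
      Real.sin ((k - 2 * l : ℕ) * φ) * Real.sin ((k - 2 * l' : ℕ) * φ) := fun φ => by
    rw [← Real.cos_sub, Nat.cast_sub hl, Nat.cast_sub hl']; push_cast; ring_nf
  have e2 : ∀ φ : ℝ, Real.sin (2 * ((l' : ℤ) - l : ℤ) * φ) =
      Real.sin ((k - 2 * l : ℕ) * φ) * Real.cos ((k - 2 * l' : ℕ) * φ) -
      Real.cos ((k - 2 * l : ℕ) * φ) * Real.sin ((k - 2 * l' : ℕ) * φ) := fun φ => by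
    rw [← Real.sin_sub, Nat.cast_sub hl, Nat.cast_sub hl']; push_cast; ring_nf
  have e3 : ∀ φ : ℝ, Real.cos (2 * ((k : ℤ) - l - l' : ℤ) * φ) =
      Real.cos ((k - 2 * l : ℕ) * φ) * Real.cos ((k - 2 * l' : ℕ) * φ) -
      Real.sin ((k - 2 * l : ℕ) * φ) * Real.sin ((k - 2 * l' : ℕ) * φ) := fun φ => by
    rw [← Real.cos_add, Nat.cast_sub hl, Nat.cast_sub hl']; push_cast; ring_nf
  have e4 : ∀ φ : ℝ, Real.sin (2 * ((k : ℤ) - l - l' : ℤ) * φ) =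
      Real.sin ((k - 2 * l : ℕ) * φ) * Real.cos ((k - 2 * l' : ℕ) * φ) +
      Real.cos ((k - 2 * l : ℕ) * φ) * Real.sin ((k - 2 * l' : ℕ) * φ) := fun φ => by
    rw [← Real.sin_add, Nat.cast_sub hl, Nat.cast_sub hl']; push_cast; ring_nf
  by_cases hkl : 2 * l = k ∧ 2 * l' = k
  · obtain ⟨h1, h2⟩ := hkl
    have h3 : l = l' := by omega
    subst h3
    simp [hb h1, h1, freqFactor]
  · have key : ∑ ν ∈ Finset.range N,
        (Real.cos ((k - 2 * l : ℕ) * θ ν) * a + Real.sin ((k - 2 * l : ℕ) * θ ν) * b) *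
        (Real.cos ((k - 2 * l' : ℕ) * θ ν) * a' + Real.sin ((k - 2 * l' : ℕ) * θ ν) * b')
      = (a * a' + b * b') / 2 * ∑ ν ∈ Finset.range N, Real.cos (2 * ((l' : ℤ) - l : ℤ) * θ ν)
        + (b * a' - a * b') / 2 * ∑ ν ∈ Finset.range N, Real.sin (2 * ((l' : ℤ) - l : ℤ) * θ ν)
        + (a * a' - b * b') / 2 * ∑ ν ∈ Finset.range N,
            Real.cos (2 * ((k : ℤ) - l - l' : ℤ) * θ ν)
        + (b * a' + a * b') / 2 * ∑ ν ∈ Finset.range N,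
            Real.sin (2 * ((k : ℤ) - l - l' : ℤ) * θ ν) := by
      simp only [Finset.mul_sum, ← Finset.sum_add_distrib, e1, e2, e3, e4]
      exact Finset.sum_congr rfl fun ν _ => by ring
    -- `k - l - l'` vanishes only if `2l = 2l' = k`, the case already treated.
    have h3 := h ((k : ℤ) - l - l') (by omega) (by rw [abs_le]; omega)
    rw [key, h3.1, h3.2]
    by_cases hll : l = l'
    · subst hll
      have : 2 * l < k := by omega
      simp [freqFactor, this]
      ring
    · have h4 := h ((l' : ℤ) - l) (by omega) (by rw [abs_le]; omega)
      rw [h4.1, h4.2, if_neg hll]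
      ring

/-- The normalizing constants of the disk polynomials. -/
def reproConst (μ : ℝ) (k l : ℕ) : ℝ :=
  freqFactor k l * ((k + μ + 1 / 2) / (μ + 1 / 2)) *
    (rising (μ + 1 / 2) (k - l) / (k - l).factorial) * (l.factorial / rising (μ + 1 / 2) l)

/-- The reproducing kernel of `V_k`. -/
def reproKernel (μ : ℝ) (k : ℕ) (z p : ℝ × ℝ) : ℝ :=
  ∑ l ∈ Finset.range (k + 1) with 2 * l ≤ k, ∑ ε : Fin 2,
    reproConst μ k l * zernike μ k l ε p * zernike μ k l ε z

theorem zernike_one_eq_zero (μ : ℝ) {k l : ℕ} (h : 2 * l = k) (p : ℝ × ℝ) :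
    zernike μ k l 1 p = 0 := by
  simp [zernike, h]

/-- Both factors are trigonometric sums in `θ ν` over the same frequencies, so the quadrature leaves
the diagonal `l = l'`; the product of the two coefficients there is `reproConst`. -/
theorem IsQuadrature.sum_gegenbauer_mul_dKernel {μ : ℝ} (hμ : 0 ≤ μ) {n N : ℕ} {θ : ℕ → ℝ}
    (h : IsQuadrature n N θ) {k : ℕ} (hk : k ≤ n) (z p : ℝ × ℝ) :
    ∑ ν ∈ Finset.range N, (k + μ + 1 / 2) / (μ + 1 / 2) *
        gegenbauer (μ + 1 / 2) k (z.1 * Real.cos (θ ν) + z.2 * Real.sin (θ ν)) *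
        dKernel μ k (θ ν) p
      = N * reproKernel μ k z p := by
  have h1 : ∀ ν, (k + μ + 1 / 2) / (μ + 1 / 2) *
        gegenbauer (μ + 1 / 2) k (z.1 * Real.cos (θ ν) + z.2 * Real.sin (θ ν)) *
        dKernel μ k (θ ν) p
      = ∑ l ∈ Finset.range (k + 1) with 2 * l ≤ k, ∑ l' ∈ Finset.range (k + 1) with 2 * l' ≤ k,
        (k + μ + 1 / 2) / (μ + 1 / 2) * (rising (μ + 1 / 2) (k - l) / (k - l).factorial) *
        (freqFactor k l' * (l'.factorial / rising (μ + 1 / 2) l')) *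
        (freqFactor k l * ((Real.cos ((k - 2 * l : ℕ) * θ ν) * zernike μ k l 0 z +
          Real.sin ((k - 2 * l : ℕ) * θ ν) * zernike μ k l 1 z) *
        (Real.cos ((k - 2 * l' : ℕ) * θ ν) * zernike μ k l' 0 p +
          Real.sin ((k - 2 * l' : ℕ) * θ ν) * zernike μ k l' 1 p))) := by
    intro ν
    have hG := gegenbauer_eq_sum_zernike μ k (z.1 * Real.cos (θ ν) + z.2 * Real.sin (θ ν),
      z.2 * Real.cos (θ ν) - z.1 * Real.sin (θ ν))
    simp only [zernike_rotate] at hG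
    rw [hG, dKernel_eq hμ, Finset.mul_sum _ _ ((k + μ + 1 / 2) / (μ + 1 / 2)), Finset.sum_mul_sum]
    exact Finset.sum_congr rfl fun l _ => Finset.sum_congr rfl fun l' _ => by ring
  simp only [h1]
  rw [Finset.sum_comm, reproKernel, Finset.mul_sum]
  refine Finset.sum_congr rfl fun l hl => ?_
  rw [Finset.sum_comm]
  have hl' : 2 * l ≤ k := (Finset.mem_filter.1 hl).2
  simp only [← Finset.mul_sum]
  rw [Finset.sum_congr rfl fun l' hl' => by
    rw [h.sum_mul hk (Finset.mem_filter.1 hl).2 (Finset.mem_filter.1 hl').2 _ _ _ _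
      (fun e => zernike_one_eq_zero μ e z)]]
  simp only [mul_ite, mul_zero]
  rw [Finset.sum_ite_eq, if_pos hl, Fin.sum_univ_two, reproConst]
  ring

theorem IsQuadrature.sum_phiKernel {μ : ℝ} (hμ : 0 ≤ μ) {n N : ℕ} {θ : ℕ → ℝ}
    (h : IsQuadrature n N θ) (z p : ℝ × ℝ) :
    ∑ ν ∈ Finset.range N,
        phiKernel μ n (θ ν) (z.1 * Real.cos (θ ν) + z.2 * Real.sin (θ ν)) p
      = N * ∑ k ∈ Finset.range (n + 1), reproKernel μ k z p := by
  unfold phiKernel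
  rw [Finset.sum_comm, Finset.mul_sum]
  exact Finset.sum_congr rfl fun k hk =>
    h.sum_gegenbauer_mul_dKernel hμ (Nat.lt_succ_iff.1 (Finset.mem_range.1 hk)) z p

/-- The sums are the real and imaginary parts of a geometric series with ratio `exp(2iτ√-1)`: `h1`
makes the ratio an `N`-th root of unity and `h2` keeps it different from `1`. -/
theorem isQuadrature_of_pow_eq_one {n N : ℕ} {θ : ℕ → ℝ} (τ : ℝ) (hθ : ∀ ν, θ ν = ν * τ)
    (h1 : ∃ a : ℤ, N * τ = a * Real.pi)
    (h2 : ∀ i : ℤ, i ≠ 0 → |i| ≤ n → ∀ b : ℤ, i * τ ≠ b * Real.pi) : IsQuadrature n N θ := by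
  intro i hi hin
  obtain ⟨a, ha⟩ := h1
  set w : ℂ := Complex.exp (2 * i * τ * Complex.I) with hw
  have hw1 : w ≠ 1 := by
    intro h
    obtain ⟨b, hb⟩ := Complex.exp_eq_one_iff.1 h
    refine h2 i hi hin b ?_
    have : (2 * i * τ : ℂ) = 2 * b * Real.pi := by
      apply mul_right_cancel₀ Complex.I_ne_zero
      rw [hb]
      ring
    have h' : (2 * i * τ : ℝ) = 2 * b * Real.pi := by exact_mod_cast this
    linarith
  have hwN : w ^ N = 1 := by
    rw [hw, ← Complex.exp_nat_mul, Complex.exp_eq_one_iff]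
    refine ⟨i * a, ?_⟩
    have : (N * τ : ℂ) = a * Real.pi := by exact_mod_cast ha
    push_cast
    linear_combination 2 * i * Complex.I * this
  have hsum : ∑ ν ∈ Finset.range N, w ^ ν = 0 := by
    rw [geom_sum_eq hw1, hwN, sub_self, zero_div]
  have hterm : ∀ ν, w ^ ν = Complex.exp ((2 * i * θ ν : ℝ) * Complex.I) := by
    intro ν
    rw [hw, ← Complex.exp_nat_mul, hθ]
    congr 1
    push_cast
    ring
  simp only [hterm] at hsum
  constructor
  · have := congrArg Complex.re hsum
    simpa only [Complex.re_sum, Complex.exp_ofReal_mul_I_re, Complex.zero_re] using this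
  · have := congrArg Complex.im hsum
    simpa only [Complex.im_sum, Complex.exp_ofReal_mul_I_im, Complex.zero_im] using this

theorem isQuadrature_xiAngle (n : ℕ) : IsQuadrature n (n + 1) (xiAngle n) := by
  have hn : (n : ℝ) + 1 ≠ 0 := by positivity
  refine isQuadrature_of_pow_eq_one (Real.pi / (n + 1)) (fun ν => mul_div_assoc _ _ _)
    ⟨1, by push_cast; field_simp⟩ fun i hi hin b hb => ?_
  have h : (i : ℝ) = b * (n + 1) := by
    field_simp at hb
    linarith
  have h' : i = b * (n + 1) := by exact_mod_cast h
  have hd : ((n : ℤ) + 1) ∣ i := ⟨b, by rw [h']; ring⟩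
  have := Int.le_of_dvd (abs_pos.2 hi) ((dvd_abs _ _).2 hd)
  omega

theorem isQuadrature_xiAngle_two_mul (n : ℕ) : IsQuadrature n (2 * n + 2) (xiAngle n) := by
  have hn : (n : ℝ) + 1 ≠ 0 := by positivity
  refine isQuadrature_of_pow_eq_one (Real.pi / (n + 1)) (fun ν => mul_div_assoc _ _ _)
    ⟨2, by push_cast; field_simp⟩ fun i hi hin b hb => ?_
  have h : (i : ℝ) = b * (n + 1) := by
    field_simp at hb
    linarith
  have h' : i = b * (n + 1) := by exact_mod_cast h
  have hd : ((n : ℤ) + 1) ∣ i := ⟨b, by rw [h']; ring⟩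
  have := Int.le_of_dvd (abs_pos.2 hi) ((dvd_abs _ _).2 hd)
  omega

theorem isQuadrature_phiAngle (m : ℕ) : IsQuadrature (2 * m) (2 * m + 1) (phiAngle m) := by
  have hn : 2 * (m : ℝ) + 1 ≠ 0 := by positivity
  refine isQuadrature_of_pow_eq_one (2 * Real.pi / (2 * m + 1))
    (fun ν => by unfold phiAngle; ring) ⟨2, by push_cast; field_simp⟩ fun i hi hin b hb => ?_
  have h : 2 * (i : ℝ) = b * (2 * m + 1) := by
    field_simp at hb
    linarith
  have h' : 2 * i = b * (2 * m + 1) := by exact_mod_cast h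
  -- The angles step by `2π/(2m+1)`, so divisibility is first known for `2i`; the factor `2` is
  -- removed because `2m + 1` is odd. This is why the even degree `2m` is needed here.
  have hd : (2 * (m : ℤ) + 1) ∣ i := by
    refine Int.dvd_of_dvd_mul_right_of_gcd_one (a := 2 * (m : ℤ) + 1) (b := 2) (c := i)
      ⟨b, by rw [h']; ring⟩ ?_
    rw [← Int.isCoprime_iff_gcd_eq_one]
    exact ⟨1, -m, by ring⟩
  have := Int.le_of_dvd (abs_pos.2 hi) ((dvd_abs _ _).2 hd)
  push_cast at hin
  omega

/-! ### Integration along chords -/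

/-- The rotation of the plane taking `(t, s)` to the point `linePoint θ t s`. -/
def lineEquiv (θ : ℝ) : ℝ × ℝ ≃ᵐ ℝ × ℝ :=
  (Complex.measurableEquivRealProd.symm.trans
    (rotation (Circle.exp θ)).toMeasurableEquiv).trans Complex.measurableEquivRealProd

theorem lineEquiv_apply (θ : ℝ) (q : ℝ × ℝ) : lineEquiv θ q = linePoint θ q.1 q.2 := by
  obtain ⟨t, s⟩ := q
  have h : (Circle.exp θ : ℂ) = ⟨Real.cos θ, Real.sin θ⟩ := by
    rw [Circle.coe_exp]
    exact Complex.ext (Complex.exp_ofReal_mul_I_re θ) (Complex.exp_ofReal_mul_I_im θ)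
  simp only [lineEquiv, MeasurableEquiv.trans_apply, Complex.measurableEquivRealProd_apply,
    LinearIsometryEquiv.coe_toMeasurableEquiv, rotation_apply, h, linePoint,
    Complex.measurableEquivRealProd_symm_apply, Complex.mul_re, Complex.mul_im]
  ext <;> simp <;> ring

theorem measurePreserving_lineEquiv (θ : ℝ) : MeasurePreserving (lineEquiv θ) :=
  ((Complex.volume_preserving_equiv_real_prod.symm _).trans
    (rotation (Circle.exp θ)).measurePreserving).trans Complex.volume_preserving_equiv_real_prod

theorem linePoint_sq_add_sq (θ t s : ℝ) :
    (linePoint θ t s).1 ^ 2 + (linePoint θ t s).2 ^ 2 = t ^ 2 + s ^ 2 := by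
  have := Real.sin_sq_add_cos_sq θ
  simp only [linePoint]
  linear_combination (t ^ 2 + s ^ 2) * this

theorem linePoint_mul_cos_add_mul_sin (θ t s : ℝ) :
    (linePoint θ t s).1 * Real.cos θ + (linePoint θ t s).2 * Real.sin θ = t := by
  have := Real.sin_sq_add_cos_sq θ
  simp only [linePoint]
  linear_combination t * this

theorem linePoint_mem_disk_iff {θ t s : ℝ} (ht : t ^ 2 ≤ 1) :
    linePoint θ t s ∈ disk ↔ s ∈ Set.Icc (-√(1 - t ^ 2)) √(1 - t ^ 2) := by
  have h : linePoint θ t s ∈ disk ↔ s ^ 2 ≤ 1 - t ^ 2 := by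
    change (linePoint θ t s).1 ^ 2 + (linePoint θ t s).2 ^ 2 ≤ 1 ↔ _
    rw [linePoint_sq_add_sq, le_sub_iff_add_le']
  rw [h, Set.mem_Icc, Real.sq_le (by linarith)]

theorem linePoint_notMem_disk {θ t s : ℝ} (ht : 1 < t ^ 2) : linePoint θ t s ∉ disk := by
  intro h
  have h' : (linePoint θ t s).1 ^ 2 + (linePoint θ t s).2 ^ 2 ≤ 1 := h
  rw [linePoint_sq_add_sq] at h'
  nlinarith [sq_nonneg s]

/-- Trades the moving endpoints for an indicator, ready for Fubini on the plane. For `t² > 1` the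
square root is zero by convention and the line misses the disk, so both sides vanish. -/
theorem integral_chord (θ t : ℝ) (g : ℝ × ℝ → ℝ) :
    ∫ s in (-√(1 - t ^ 2))..√(1 - t ^ 2), g (linePoint θ t s)
      = ∫ s, disk.indicator g (linePoint θ t s) := by
  rcases le_or_gt (t ^ 2) 1 with ht | ht
  · rw [intervalIntegral.integral_of_le (by linarith [Real.sqrt_nonneg (1 - t ^ 2)]),
      ← integral_Icc_eq_integral_Ioc, ← integral_indicator measurableSet_Icc]
    congr 1
    ext s
    by_cases hs : s ∈ Set.Icc (-√(1 - t ^ 2)) √(1 - t ^ 2)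
    · rw [Set.indicator_of_mem hs, Set.indicator_of_mem ((linePoint_mem_disk_iff ht).2 hs)]
    · rw [Set.indicator_of_notMem hs,
        Set.indicator_of_notMem (fun h => hs ((linePoint_mem_disk_iff ht).1 h))]
  · simp [Real.sqrt_eq_zero_of_nonpos (show 1 - t ^ 2 ≤ 0 by linarith),
      Set.indicator_of_notMem (linePoint_notMem_disk (θ := θ) ht)]

theorem isCompact_disk : IsCompact disk := by
  refine Metric.isCompact_of_isClosed_isBounded
    (isClosed_le (by fun_prop) continuous_const) ?_
  refine (Metric.isBounded_closedBall (x := (0 : ℝ × ℝ)) (r := 1)).subset fun p hp => ?_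
  have h : p.1 ^ 2 + p.2 ^ 2 ≤ 1 := hp
  rw [mem_closedBall_zero_iff, Prod.norm_def, max_le_iff, Real.norm_eq_abs, Real.norm_eq_abs]
  exact ⟨abs_le_one_iff_mul_self_le_one.2 (by nlinarith [sq_nonneg p.2]),
    abs_le_one_iff_mul_self_le_one.2 (by nlinarith [sq_nonneg p.1])⟩

theorem integrable_indicator_mul_weight {μ : ℝ} (hμ : 0 ≤ μ) {f : ℝ × ℝ → ℝ}
    (hf : Integrable f (diskMeasure μ)) {h : ℝ × ℝ → ℝ} (hh : Continuous h) :
    Integrable (disk.indicator fun p => f p * weight μ p * h p) := by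
  rw [integrable_indicator_iff measurableSet_disk]
  refine IntegrableOn.mul_continuousOn ?_ hh.continuousOn isCompact_disk
  unfold diskMeasure at hf
  rw [integrable_withDensity_iff_integrable_smul'
    ((measurable_weight μ).const_mul _).ennreal_ofReal
    (Eventually.of_forall fun _ => ENNReal.ofReal_lt_top)] at hf
  refine (hf.const_mul (aConst μ)⁻¹).congr ?_
  filter_upwards [ae_restrict_mem measurableSet_disk] with p hp
  rw [ENNReal.toReal_ofReal (mul_nonneg (aConst_pos hμ).le (weight_nonneg μ hp)), smul_eq_mul]
  have := (aConst_pos hμ).ne'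
  field_simp

theorem integrable_comp_linePoint {g : ℝ × ℝ → ℝ} (hg : Integrable g) (θ : ℝ) :
    Integrable (fun q : ℝ × ℝ => g (linePoint θ q.1 q.2)) (volume.prod volume) := by
  have := ((measurePreserving_lineEquiv θ).integrable_comp_emb
    (lineEquiv θ).measurableEmbedding).2 hg
  refine this.congr (Eventually.of_forall fun q => ?_)
  simp only [Function.comp_apply, lineEquiv_apply]

theorem integral_comp_linePoint (g : ℝ × ℝ → ℝ) (θ : ℝ) :
    ∫ q : ℝ × ℝ, g (linePoint θ q.1 q.2) ∂(volume.prod volume) = ∫ p, g p := by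
  rw [← (measurePreserving_lineEquiv θ).integral_comp']
  simp only [lineEquiv_apply]
  rfl

theorem ae_intervalIntegrable_chord {μ : ℝ} (hμ : 0 ≤ μ) {f : ℝ × ℝ → ℝ}
    (hf : Integrable f (diskMeasure μ)) (θ : ℝ) :
    ∀ᵐ t, IntervalIntegrable (fun s => f (linePoint θ t s) * weight μ (linePoint θ t s))
      volume (-√(1 - t ^ 2)) √(1 - t ^ 2) := by
  have h := integrable_comp_linePoint
    (integrable_indicator_mul_weight hμ hf (h := fun _ => 1) continuous_const) θ
  filter_upwards [h.prod_right_ae] with t ht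
  rcases le_or_gt (t ^ 2) 1 with h1 | h1
  · rw [intervalIntegrable_iff_integrableOn_Icc_of_le
      (by linarith [Real.sqrt_nonneg (1 - t ^ 2)])]
    refine (ht.integrableOn (s := Set.Icc (-√(1 - t ^ 2)) √(1 - t ^ 2))).congr_fun
      (fun s hs => ?_) measurableSet_Icc
    simp [Set.indicator_of_mem ((linePoint_mem_disk_iff (θ := θ) h1).2 hs)]
  · simp [Real.sqrt_eq_zero_of_nonpos (show 1 - t ^ 2 ≤ 0 by linarith)]

/-- On the chord `⟨p, θ⟩` is constantly `t`, so `h t` can be moved under the integral as a ridge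
function. -/
theorem radon_mul (μ θ : ℝ) (f : ℝ × ℝ → ℝ) (h : ℝ → ℝ) (t : ℝ) :
    radon μ θ f t * h t = ∫ s, disk.indicator
      (fun p => f p * weight μ p * h (p.1 * Real.cos θ + p.2 * Real.sin θ))
        (linePoint θ t s) := by
  rw [← integral_chord, radon, ← intervalIntegral.integral_mul_const]
  simp only [linePoint_mul_cos_add_mul_sin]

theorem integrable_radon_mul {μ : ℝ} (hμ : 0 ≤ μ) {f : ℝ × ℝ → ℝ}
    (hf : Integrable f (diskMeasure μ)) (θ : ℝ) {h : ℝ → ℝ} (hh : Continuous h) :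
    Integrable fun t => radon μ θ f t * h t := by
  simp only [radon_mul]
  exact (integrable_comp_linePoint (integrable_indicator_mul_weight hμ hf (by fun_prop))
    θ).integral_prod_left

theorem radon_eq_zero {μ θ t : ℝ} (f : ℝ × ℝ → ℝ) (ht : 1 < t ^ 2) : radon μ θ f t = 0 := by
  simp [radon, Real.sqrt_eq_zero_of_nonpos (show 1 - t ^ 2 ≤ 0 by linarith)]

/-- Fubini in the rotated coordinates `(t, s)`, which preserve area. The integral over `[-1,1]` may
be extended to the line because the Radon projection vanishes beyond. -/
theorem integral_radon_mul {μ : ℝ} (hμ : 0 ≤ μ) {f : ℝ × ℝ → ℝ}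
    (hf : Integrable f (diskMeasure μ)) (θ : ℝ) {h : ℝ → ℝ} (hh : Continuous h) :
    aConst μ * ∫ t in (-1 : ℝ)..1, radon μ θ f t * h t
      = ∫ p, f p * h (p.1 * Real.cos θ + p.2 * Real.sin θ) ∂(diskMeasure μ) := by
  rw [intervalIntegral.integral_of_le (by norm_num), ← integral_Icc_eq_integral_Ioc,
    setIntegral_eq_integral_of_forall_compl_eq_zero]
  · simp only [radon_mul]
    rw [integral_integral (integrable_comp_linePoint (integrable_indicator_mul_weight hμ hf
        (h := fun p => h (p.1 * Real.cos θ + p.2 * Real.sin θ)) (by fun_prop)) θ),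
      integral_comp_linePoint,
      integral_indicator measurableSet_disk, integral_diskMeasure hμ, ← integral_const_mul]
    congr 1
    ext p
    ring
  · intro t ht
    rw [radon_eq_zero, zero_mul]
    rw [Set.mem_Icc, ← abs_le, not_le] at ht
    exact (one_lt_sq_iff_one_lt_abs t).2 ht

/-! ### Polynomial functions on the plane -/

/-- The functions given by polynomials of total degree at most `n`. -/
def polyFun (n : ℕ) : Submodule ℝ (ℝ × ℝ → ℝ) where
  carrier := {g | ∃ P ∈ MvPolynomial.restrictTotalDegree (Fin 2) ℝ n, g = evalAt P}
  zero_mem' := ⟨0, Submodule.zero_mem _, by ext; simp [evalAt]⟩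
  add_mem' := by
    rintro _ _ ⟨P, hP, rfl⟩ ⟨Q, hQ, rfl⟩
    exact ⟨P + Q, Submodule.add_mem _ hP hQ, by ext; simp [evalAt]⟩
  smul_mem' := by
    rintro c _ ⟨P, hP, rfl⟩
    exact ⟨c • P, Submodule.smul_mem _ c hP, by ext; simp [evalAt]⟩

theorem polyFun_mul {m n : ℕ} {g h : ℝ × ℝ → ℝ} (hg : g ∈ polyFun m) (hh : h ∈ polyFun n) :
    (fun p => g p * h p) ∈ polyFun (m + n) := by
  obtain ⟨P, hP, rfl⟩ := hg
  obtain ⟨Q, hQ, rfl⟩ := hh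
  rw [MvPolynomial.mem_restrictTotalDegree] at hP hQ
  refine ⟨P * Q, ?_, by ext; simp [evalAt]⟩
  rw [MvPolynomial.mem_restrictTotalDegree]
  exact (MvPolynomial.totalDegree_mul P Q).trans (add_le_add hP hQ)

theorem polyFun_mono {m n : ℕ} (h : m ≤ n) : polyFun m ≤ polyFun n := by
  rintro _ ⟨P, hP, rfl⟩
  rw [MvPolynomial.mem_restrictTotalDegree] at hP
  exact ⟨P, (MvPolynomial.mem_restrictTotalDegree _ _ _).2 (hP.trans h), rfl⟩

theorem const_mem_polyFun (c : ℝ) : (fun _ => c) ∈ polyFun 0 :=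
  ⟨MvPolynomial.C c, by simp [MvPolynomial.mem_restrictTotalDegree], by ext; simp [evalAt]⟩

theorem fst_mem_polyFun : (fun p : ℝ × ℝ => p.1) ∈ polyFun 1 :=
  ⟨MvPolynomial.X 0, by simp [MvPolynomial.mem_restrictTotalDegree], by ext; simp [evalAt]⟩

theorem snd_mem_polyFun : (fun p : ℝ × ℝ => p.2) ∈ polyFun 1 :=
  ⟨MvPolynomial.X 1, by simp [MvPolynomial.mem_restrictTotalDegree], by ext; simp [evalAt]⟩

theorem polyFun_pow {m : ℕ} {g : ℝ × ℝ → ℝ} (hg : g ∈ polyFun m) (s : ℕ) :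
    (fun p => g p ^ s) ∈ polyFun (m * s) := by
  induction s with
  | zero => simpa using const_mem_polyFun 1
  | succ s ih => simpa only [pow_succ, Nat.mul_succ] using polyFun_mul ih hg

theorem continuous_of_mem_polyFun {n : ℕ} {g : ℝ × ℝ → ℝ} (hg : g ∈ polyFun n) :
    Continuous g := by
  obtain ⟨P, -, rfl⟩ := hg
  unfold evalAt
  refine (MvPolynomial.continuous_eval P).comp (continuous_pi fun i => ?_)
  fin_cases i
  · exact continuous_fst
  · exact continuous_snd

theorem solid_succ_zero (j : ℕ) (p : ℝ × ℝ) :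
    solid (j + 1) 0 p = p.1 * solid j 0 p - p.2 * solid j 1 p := by
  simp only [solid, if_true, one_ne_zero, if_false, pow_succ, Complex.mul_re]
  ring

theorem solid_succ_one (j : ℕ) (p : ℝ × ℝ) :
    solid (j + 1) 1 p = p.1 * solid j 1 p + p.2 * solid j 0 p := by
  simp only [solid, if_true, one_ne_zero, if_false, pow_succ, Complex.mul_im]
  ring

theorem solid_mem_polyFun (j : ℕ) : ∀ ε, solid j ε ∈ polyFun j := by
  rw [Fin.forall_fin_two]
  induction j with
  | zero =>
    refine ⟨?_, ?_⟩
    · convert! const_mem_polyFun 1 using 1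
    · convert! const_mem_polyFun 0 using 1
  | succ j ih =>
    rw [add_comm]
    refine ⟨?_, ?_⟩
    · convert! Submodule.sub_mem _ (polyFun_mul fst_mem_polyFun ih.1)
        (polyFun_mul snd_mem_polyFun ih.2) using 1
      ext p
      rw [add_comm 1, solid_succ_zero]
      rfl
    · convert! Submodule.add_mem _ (polyFun_mul fst_mem_polyFun ih.2)
        (polyFun_mul snd_mem_polyFun ih.1) using 1
      ext p
      rw [add_comm 1, solid_succ_one]
      rfl

theorem sq_add_sq_mem_polyFun : (fun p : ℝ × ℝ => p.1 ^ 2 + p.2 ^ 2) ∈ polyFun 2 :=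
  Submodule.add_mem _ (polyFun_pow fst_mem_polyFun 2) (polyFun_pow snd_mem_polyFun 2)

theorem zernike_eq_sum (μ : ℝ) (k l : ℕ) (ε : Fin 2) : zernike μ k l ε =
    ∑ i ∈ Finset.range (l + 1), ((-1) ^ (l - i) * rising ((k - 2 * l : ℕ) + 1 + i) (l - i) *
      rising (l + (μ - 1 / 2) + (k - 2 * l : ℕ) + 1) i /
        ((i.factorial : ℝ) * ((l - i).factorial : ℝ))) •
      (fun p : ℝ × ℝ => (p.1 ^ 2 + p.2 ^ 2) ^ i * solid (k - 2 * l) ε p) := by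
  ext p
  rw [zernike, jacobi_two_mul_sub_one, Finset.sum_mul, Finset.sum_apply]
  refine Finset.sum_congr rfl fun i _ => ?_
  rw [Pi.smul_apply, smul_eq_mul, mul_assoc]

theorem zernike_mem_polyFun (μ : ℝ) {k l : ℕ} (hl : 2 * l ≤ k) (ε : Fin 2) :
    zernike μ k l ε ∈ polyFun k := by
  rw [zernike_eq_sum]
  refine Submodule.sum_mem _ fun i hi => Submodule.smul_mem _ _ ?_
  rw [Finset.mem_range] at hi
  exact polyFun_mono (by omega)
    (polyFun_mul (polyFun_pow sq_add_sq_mem_polyFun i) (solid_mem_polyFun (k - 2 * l) ε))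

/-- The span of the functions `r^(2i) r^j S_{j,ε}(φ)` with `2i + j ≤ n`. -/
def solidSpan (n : ℕ) : Submodule ℝ (ℝ × ℝ → ℝ) :=
  Submodule.span ℝ {g | ∃ (i j : ℕ) (ε : Fin 2), 2 * i + j ≤ n ∧
    g = fun p : ℝ × ℝ => (p.1 ^ 2 + p.2 ^ 2) ^ i * solid j ε p}

theorem mem_solidSpan {n i j : ℕ} (ε : Fin 2) (h : 2 * i + j ≤ n) :
    (fun p : ℝ × ℝ => (p.1 ^ 2 + p.2 ^ 2) ^ i * solid j ε p) ∈ solidSpan n :=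
  Submodule.subset_span ⟨i, j, ε, h, rfl⟩

/-- With `w = x + iy`, `2x w^(j+1) = w^(j+2) + |w|² w^j`; real and imaginary parts give the two
values of `ε`. -/
theorem fst_mul_mem_solidSpan {n : ℕ} {g : ℝ × ℝ → ℝ} (hg : g ∈ solidSpan n) :
    (fun p => p.1 * g p) ∈ solidSpan (n + 1) := by
  induction hg using Submodule.span_induction with
  | mem g hg =>
    obtain ⟨i, j, ε, hij, rfl⟩ := hg
    cases j with
    | zero =>
      revert ε
      rw [Fin.forall_fin_two]
      refine ⟨?_, ?_⟩
      · convert! mem_solidSpan (n := n + 1) (i := i) (j := 1) 0 (by omega) using 1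
        ext p
        rw [solid_succ_zero]
        simp
        ring
      · convert! Submodule.zero_mem _ using 1
        ext p
        simp
    | succ j =>
      have h := Submodule.smul_mem (solidSpan (n + 1)) (1 / 2 : ℝ) (Submodule.add_mem _
        (mem_solidSpan (n := n + 1) (i := i) (j := j + 2) ε (by omega))
        (mem_solidSpan (n := n + 1) (i := i + 1) (j := j) ε (by omega)))
      convert! h using 1
      ext p
      revert ε
      rw [Fin.forall_fin_two]
      constructor <;> intros <;>
        simp only [Pi.smul_apply, Pi.add_apply, solid_succ_zero, solid_succ_one, smul_eq_mul] <;>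
        ring
  | zero =>
    convert! Submodule.zero_mem _ using 1
    ext p
    simp
  | add g h _ _ ihg ihh =>
    convert! Submodule.add_mem _ ihg ihh using 1
    ext p
    simp [mul_add]
  | smul c g _ ih =>
    convert! Submodule.smul_mem _ c ih using 1
    ext p
    simp
    ring

theorem snd_mul_mem_solidSpan {n : ℕ} {g : ℝ × ℝ → ℝ} (hg : g ∈ solidSpan n) :
    (fun p => p.2 * g p) ∈ solidSpan (n + 1) := by
  induction hg using Submodule.span_induction with
  | mem g hg =>
    obtain ⟨i, j, ε, hij, rfl⟩ := hg
    cases j with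
    | zero =>
      revert ε
      rw [Fin.forall_fin_two]
      refine ⟨?_, ?_⟩
      · convert! mem_solidSpan (n := n + 1) (i := i) (j := 1) 1 (by omega) using 1
        ext p
        rw [solid_succ_one]
        simp
        ring
      · convert! Submodule.zero_mem _ using 1
        ext p
        simp
    | succ j =>
      -- Now `2iy w^(j+1) = w^(j+2) - |w|² w^j`; the factor `i` exchanges real and imaginary parts,
      -- with one sign.
      have h := fun ε => Submodule.sub_mem (solidSpan (n + 1))
        (mem_solidSpan (n := n + 1) (i := i) (j := j + 2) ε (by omega))
        (mem_solidSpan (n := n + 1) (i := i + 1) (j := j) ε (by omega))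
      revert ε
      rw [Fin.forall_fin_two]
      refine ⟨?_, ?_⟩
      · convert! Submodule.smul_mem _ (1 / 2 : ℝ) (h 1) using 1
        ext p
        simp only [Pi.smul_apply, Pi.sub_apply, solid_succ_zero, solid_succ_one, smul_eq_mul]
        ring
      · convert! Submodule.smul_mem _ (-(1 / 2) : ℝ) (h 0) using 1
        ext p
        simp only [Pi.smul_apply, Pi.sub_apply, solid_succ_zero, solid_succ_one, smul_eq_mul]
        ring
  | zero =>
    convert! Submodule.zero_mem _ using 1
    ext p
    simp
  | add g h _ _ ihg ihh =>
    convert! Submodule.add_mem _ ihg ihh using 1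
    ext p
    simp [mul_add]
  | smul c g _ ih =>
    convert! Submodule.smul_mem _ c ih using 1
    ext p
    simp
    ring

theorem solidSpan_mono {m n : ℕ} (h : m ≤ n) : solidSpan m ≤ solidSpan n :=
  Submodule.span_mono fun _ ⟨i, j, ε, hij, hg⟩ => ⟨i, j, ε, hij.trans h, hg⟩

theorem pow_mul_pow_mem_solidSpan (a b : ℕ) :
    (fun p : ℝ × ℝ => p.1 ^ a * p.2 ^ b) ∈ solidSpan (a + b) := by
  induction a with
  | zero =>
    induction b with
    | zero => simpa using mem_solidSpan (n := 0) (i := 0) (j := 0) 0 le_rfl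
    | succ b ih =>
      convert! snd_mul_mem_solidSpan ih using 1
      ext p
      ring
  | succ a ih =>
    rw [add_right_comm]
    convert! fst_mul_mem_solidSpan ih using 1
    ext p
    ring

theorem polyFun_le_solidSpan (n : ℕ) : polyFun n ≤ solidSpan n := by
  rintro _ ⟨P, hP, rfl⟩
  rw [MvPolynomial.mem_restrictTotalDegree] at hP
  have h : evalAt P = ∑ m ∈ P.support, P.coeff m • fun p : ℝ × ℝ => p.1 ^ m 0 * p.2 ^ m 1 := by
    ext p
    simp [evalAt, MvPolynomial.eval_eq', Fin.prod_univ_two]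
  rw [h]
  refine Submodule.sum_mem _ fun m hm => Submodule.smul_mem _ _ ?_
  refine solidSpan_mono ?_ (pow_mul_pow_mem_solidSpan (m 0) (m 1))
  have := (MvPolynomial.le_totalDegree hm).trans hP
  rwa [Finsupp.sum_fintype _ _ (fun _ => rfl), Fin.sum_univ_two] at this

/-- The span of the disk polynomials of degree at most `n`. -/
def zernikeSpan (μ : ℝ) (n : ℕ) : Submodule ℝ (ℝ × ℝ → ℝ) :=
  Submodule.span ℝ {g | ∃ (k l : ℕ) (ε : Fin 2), 2 * l ≤ k ∧ k ≤ n ∧ g = zernike μ k l ε}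

/-- The passage between the two families is triangular: the disk polynomial with `l = i` has a
nonzero coefficient at `r^(2i)` and otherwise lower powers, already covered by induction. -/
theorem sq_add_sq_pow_mul_solid_mem_zernikeSpan {μ : ℝ} (hμ : 0 ≤ μ) (n i j : ℕ) (ε : Fin 2)
    (h : 2 * i + j ≤ n) :
    (fun p : ℝ × ℝ => (p.1 ^ 2 + p.2 ^ 2) ^ i * solid j ε p) ∈ zernikeSpan μ n := by
  induction i using Nat.strong_induction_on with
  | _ i ih =>
    have hz : zernike μ (2 * i + j) i ε ∈ zernikeSpan μ n :=
      Submodule.subset_span ⟨_, _, _, by omega, h, rfl⟩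
    rw [zernike_eq_sum, Finset.sum_range_succ] at hz
    have h2 := (Submodule.add_mem_iff_right _ (Submodule.sum_mem _ fun s hs =>
      Submodule.smul_mem _ _ ?_)).1 hz
    · rw [Nat.add_sub_cancel_left, Nat.sub_self, Submodule.smul_mem_iff] at h2
      · exact h2
      · have hc : (0 : ℝ) < i + (μ - 1 / 2) + j + 1 := by
          have : (0 : ℝ) ≤ i := by positivity
          have : (0 : ℝ) ≤ j := by positivity
          linarith
        have := rising_pos hc i
        simp only [pow_zero, rising_zero, Nat.factorial_zero, one_mul]
        positivity
    · rw [Finset.mem_range] at hs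
      rw [Nat.add_sub_cancel_left]
      exact ih s hs (by omega)

theorem polyFun_le_zernikeSpan {μ : ℝ} (hμ : 0 ≤ μ) (n : ℕ) : polyFun n ≤ zernikeSpan μ n := by
  refine (polyFun_le_solidSpan n).trans (Submodule.span_le.2 ?_)
  rintro _ ⟨i, j, ε, h, rfl⟩
  exact sq_add_sq_pow_mul_solid_mem_zernikeSpan hμ n i j ε h

/-! ### The reproducing property -/

theorem memLp_of_continuous {μ : ℝ} (hμ : 0 ≤ μ) {g : ℝ × ℝ → ℝ} (hg : Continuous g) :
    MemLp g 2 (diskMeasure μ) := by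
  have := isFiniteMeasure_diskMeasure hμ
  obtain ⟨C, hC⟩ := isCompact_disk.exists_bound_of_continuousOn hg.continuousOn
  refine MemLp.of_bound hg.aestronglyMeasurable C ?_
  have h : ∀ᵐ p ∂(volume.restrict disk), ‖g p‖ ≤ C := by
    filter_upwards [ae_restrict_mem measurableSet_disk] with p hp using hC p hp
  exact (withDensity_absolutelyContinuous _ _).ae_le h

theorem integrable_continuous_mul {μ : ℝ} (hμ : 0 ≤ μ) {g f : ℝ × ℝ → ℝ} (hg : Continuous g)
    (hf : MemLp f 2 (diskMeasure μ)) : Integrable (fun p => g p * f p) (diskMeasure μ) :=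
  (memLp_of_continuous hμ hg).integrable_mul hf

theorem continuous_zernike (μ : ℝ) {k l : ℕ} (hl : 2 * l ≤ k) (ε : Fin 2) :
    Continuous (zernike μ k l ε) := continuous_of_mem_polyFun (zernike_mem_polyFun μ hl ε)

theorem reproKernel_mem_polyFun (μ : ℝ) (k : ℕ) (p : ℝ × ℝ) :
    (fun z => reproKernel μ k z p) ∈ polyFun k := by
  have h : (fun z => reproKernel μ k z p)
      = ∑ l ∈ Finset.range (k + 1) with 2 * l ≤ k, ∑ ε : Fin 2,
        (reproConst μ k l * zernike μ k l ε p) • zernike μ k l ε := by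
    ext z
    simp [reproKernel]
  rw [h]
  exact Submodule.sum_mem _ fun l hl => Submodule.sum_mem _ fun ε _ =>
    Submodule.smul_mem _ _ (zernike_mem_polyFun μ (Finset.mem_filter.1 hl).2 ε)

theorem continuous_reproKernel (μ : ℝ) (k : ℕ) (p : ℝ × ℝ) :
    Continuous fun z => reproKernel μ k z p :=
  continuous_of_mem_polyFun (reproKernel_mem_polyFun μ k p)

/-- `reproConst` is the inverse squared norm. The angular part is always `2π` thanks to
`freqFactor`; the excluded case `2l = k`, `ε = 1` is the zero function. -/
theorem reproConst_mul_normSq {μ : ℝ} (hμ : 0 ≤ μ) {k l : ℕ} (hl : 2 * l ≤ k) {ε : Fin 2}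
    (h : 2 * l < k ∨ ε = 0) :
    reproConst μ k l * (aConst μ * (1 / 2 * jacobiNormSq (μ - 1 / 2) (k - 2 * l) l) *
      trigNormSq (k - 2 * l) ε) = 1 := by
  have hft : freqFactor k l * trigNormSq (k - 2 * l) ε = 2 * Real.pi := by
    unfold freqFactor trigNormSq
    by_cases h2 : 2 * l < k
    · rw [if_pos h2, if_neg (by omega)]
    · rw [if_neg h2, if_pos (by omega), if_pos (h.resolve_left h2), one_mul]
  have h1 : k - 2 * l + l = k - l := by omega
  have h2 : 2 * (l : ℝ) + (k - 2 * l : ℕ) + (μ - 1 / 2) + 1 = k + μ + 1 / 2 := by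
    rw [Nat.cast_sub hl]
    push_cast
    ring
  have h3 : μ - 1 / 2 + 1 = μ + 1 / 2 := by ring
  have hx : 0 < μ + 1 / 2 := by linarith
  have := (rising_pos hx l).ne'
  have := (rising_pos hx (k - l)).ne'
  have : (k : ℝ) + μ + 1 / 2 ≠ 0 := by positivity
  have : μ + 1 / 2 ≠ 0 := hx.ne'
  have hpi := Real.pi_ne_zero
  calc _ = freqFactor k l * trigNormSq (k - 2 * l) ε *
        (((k + μ + 1 / 2) / (μ + 1 / 2)) *
        (rising (μ + 1 / 2) (k - l) / (k - l).factorial) *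
        (l.factorial / rising (μ + 1 / 2) l) *
        (aConst μ * (1 / 2 * jacobiNormSq (μ - 1 / 2) (k - 2 * l) l))) := by
        unfold reproConst
        ring
    _ = 1 := by
        rw [hft]
        unfold jacobiNormSq aConst
        rw [h2, h3, h1, add_comm l, h1]
        generalize (k : ℝ) + μ + 1 / 2 = A at *
        generalize μ + 1 / 2 = B at *
        field_simp

theorem integral_reproKernel_mul_zernike {μ : ℝ} (hμ : 0 ≤ μ) (k : ℕ) {k' l' : ℕ}
    (hl' : 2 * l' ≤ k') (ε' : Fin 2) (p : ℝ × ℝ) :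
    ∫ z, reproKernel μ k z p * zernike μ k' l' ε' z ∂(diskMeasure μ)
      = if k = k' then zernike μ k' l' ε' p else 0 := by
  have hint : ∀ l ∈ Finset.filter (fun l => 2 * l ≤ k) (Finset.range (k + 1)), ∀ ε : Fin 2,
      Integrable (fun z => reproConst μ k l * zernike μ k l ε p *
        (zernike μ k l ε z * zernike μ k' l' ε' z)) (diskMeasure μ) := fun l hl ε =>
    (integrable_continuous_mul hμ (continuous_zernike μ (Finset.mem_filter.1 hl).2 ε)
      (memLp_of_continuous hμ (continuous_zernike μ hl' ε'))).const_mul _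
  have h1 : ∫ z, reproKernel μ k z p * zernike μ k' l' ε' z ∂(diskMeasure μ)
      = ∑ l ∈ Finset.range (k + 1) with 2 * l ≤ k, ∑ ε : Fin 2,
        reproConst μ k l * zernike μ k l ε p * (if k = k' ∧ l = l' ∧ ε = ε' then
          aConst μ * (1 / 2 * jacobiNormSq (μ - 1 / 2) (k - 2 * l) l) * trigNormSq (k - 2 * l) ε
        else 0) := by
    simp only [reproKernel, Finset.sum_mul, mul_assoc (reproConst μ k _ * _)]
    rw [integral_finsetSum _ fun l hl => integrable_finsetSum _ fun ε _ => hint l hl ε]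
    refine Finset.sum_congr rfl fun l hl => ?_
    rw [integral_finsetSum _ fun ε _ => hint l hl ε]
    refine Finset.sum_congr rfl fun ε _ => ?_
    rw [integral_const_mul, integral_zernike_mul_zernike hμ (Finset.mem_filter.1 hl).2 hl']
  rw [h1]
  by_cases hk : k = k'
  · subst hk
    rw [if_pos rfl, Finset.sum_eq_single_of_mem l' (by
      rw [Finset.mem_filter, Finset.mem_range]; omega), Finset.sum_eq_single_of_mem ε'
      (Finset.mem_univ _)]
    · rw [if_pos ⟨rfl, rfl, rfl⟩]
      by_cases h : 2 * l' < k ∨ ε' = 0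
      · have := reproConst_mul_normSq hμ hl' h
        linear_combination zernike μ k l' ε' p * this
      · push Not at h
        have h0 : ε' = 1 := by omega
        rw [h0, zernike_one_eq_zero μ (by omega) p]
        simp
    · intro ε _ hε
      simp [hε]
    · intro l _ hl
      simp [hl]
  · simp [hk]

/-- Disk polynomials span, so linearity reduces both claims to them. The first gives orthogonality
of the kernel to lower degrees, the second recovers values at all points of the plane. -/
theorem integral_reproKernel_mul {μ : ℝ} (hμ : 0 ≤ μ) {n : ℕ} {g : ℝ × ℝ → ℝ}
    (hg : g ∈ polyFun n) (p : ℝ × ℝ) :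
    (∀ k, n < k → ∫ z, reproKernel μ k z p * g z ∂(diskMeasure μ) = 0) ∧
    ∑ k ∈ Finset.range (n + 1), ∫ z, reproKernel μ k z p * g z ∂(diskMeasure μ) = g p := by
  have hcont : ∀ {g : ℝ × ℝ → ℝ}, g ∈ zernikeSpan μ n → Continuous g := fun {g} hg => by
    refine continuous_of_mem_polyFun (n := n) ((Submodule.span_le.2 ?_) hg)
    rintro _ ⟨k, l, ε, hl, hk, rfl⟩
    exact polyFun_mono hk (zernike_mem_polyFun μ hl ε)
  have hint : ∀ {g : ℝ × ℝ → ℝ}, g ∈ zernikeSpan μ n → ∀ k,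
      Integrable (fun z => reproKernel μ k z p * g z) (diskMeasure μ) := fun hg k =>
    integrable_continuous_mul hμ (continuous_reproKernel μ k p) (memLp_of_continuous hμ (hcont hg))
  replace hg := polyFun_le_zernikeSpan hμ n hg
  unfold zernikeSpan at hg
  induction hg using Submodule.span_induction with
  | mem g hg =>
    obtain ⟨k', l, ε, hl, hk, rfl⟩ := hg
    simp only [integral_reproKernel_mul_zernike hμ _ hl]
    refine ⟨fun k h => if_neg (by omega), ?_⟩
    rw [Finset.sum_ite_eq', if_pos (by rw [Finset.mem_range]; omega)]
  | zero => simp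
  | add g h hg hh ihg ihh =>
    have e : ∀ k, ∫ z, reproKernel μ k z p * (g + h) z ∂(diskMeasure μ)
        = ∫ z, reproKernel μ k z p * g z ∂(diskMeasure μ)
          + ∫ z, reproKernel μ k z p * h z ∂(diskMeasure μ) := fun k => by
      simp only [Pi.add_apply, mul_add]
      exact integral_add (hint hg k) (hint hh k)
    simp only [e]
    refine ⟨fun k hk => by rw [ihg.1 k hk, ihh.1 k hk, add_zero], ?_⟩
    rw [Finset.sum_add_distrib, ihg.2, ihh.2, Pi.add_apply]
  | smul c g hg ih =>
    have e : ∀ k, ∫ z, reproKernel μ k z p * (c • g) z ∂(diskMeasure μ)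
        = c * ∫ z, reproKernel μ k z p * g z ∂(diskMeasure μ) := fun k => by
      rw [← integral_const_mul]
      simp only [Pi.smul_apply, smul_eq_mul, mul_left_comm]
    simp only [e]
    refine ⟨fun k hk => by rw [ih.1 k hk, mul_zero], ?_⟩
    rw [← Finset.mul_sum, ih.2, Pi.smul_apply, smul_eq_mul]

/-! ### The partial sums as integral operators -/

theorem mem_polySpace_of_polyFun {μ : ℝ} {n : ℕ} {g : ℝ × ℝ → ℝ} (hg : g ∈ polyFun n)
    (hm : MemLp g 2 (diskMeasure μ)) : hm.toLp g ∈ polySpace μ n := by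
  obtain ⟨P, hP, rfl⟩ := hg
  exact ⟨P, hP, hm.coeFn_toLp⟩

theorem inner_toLp_eq {μ : ℝ} {g h : ℝ × ℝ → ℝ} (hg : MemLp g 2 (diskMeasure μ))
    {u : Lp ℝ 2 (diskMeasure μ)} (hu : u =ᵐ[diskMeasure μ] h) :
    inner ℝ (hg.toLp g) u = ∫ z, g z * h z ∂(diskMeasure μ) := by
  rw [L2.inner_def]
  refine integral_congr_ae ?_
  filter_upwards [hg.coeFn_toLp, hu] with z h1 h2
  rw [h1, h2, RCLike.inner_apply, conj_trivial, mul_comm]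

theorem reproKernel_mem_orthoSpace {μ : ℝ} (hμ : 0 ≤ μ) (k : ℕ) (p : ℝ × ℝ) :
    (memLp_of_continuous hμ (continuous_reproKernel μ k p)).toLp _ ∈ orthoSpace μ k := by
  refine Submodule.mem_inf.2 ⟨mem_polySpace_of_polyFun (reproKernel_mem_polyFun μ k p) _, ?_⟩
  simp only [Submodule.mem_iInf, Finset.mem_range]
  intro j hj
  rw [Submodule.mem_orthogonal']
  rintro u ⟨Q, hQ, hu⟩
  rw [inner_toLp_eq _ hu]
  exact (integral_reproKernel_mul hμ ⟨Q, hQ, rfl⟩ p).1 k hj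

/-- Let `q` be the projection and `P` its polynomial. Then `P(p)` is the sum over `j ≤ k` of the
inner products of `K_j(·, p)` with `q`. Those with `j < k` vanish as `q` lies in `V_k`; in the last,
`q` may be replaced by `f` since `f - q` is orthogonal to `V_k`. -/
theorem exists_proj_eq {μ : ℝ} (hμ : 0 ≤ μ) {f : ℝ × ℝ → ℝ} (hf : MemLp f 2 (diskMeasure μ))
    (k : ℕ) : ∃ P ∈ MvPolynomial.restrictTotalDegree (Fin 2) ℝ k,
      proj μ k (hf.toLp f) =ᵐ[diskMeasure μ] evalAt P ∧
      ∀ p, evalAt P p = ∫ z, reproKernel μ k z p * f z ∂(diskMeasure μ) := by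
  have hq : proj μ k (hf.toLp f) ∈ orthoSpace μ k := Submodule.starProjection_apply_mem _ _
  obtain ⟨⟨P, hP, hPe⟩, hq2⟩ := Submodule.mem_inf.1 hq
  refine ⟨P, hP, hPe, fun p => ?_⟩
  have hm := fun j => memLp_of_continuous hμ (continuous_reproKernel μ j p)
  rw [← (integral_reproKernel_mul hμ ⟨P, hP, rfl⟩ p).2, Finset.sum_range_succ,
    Finset.sum_eq_zero, zero_add, ← inner_toLp_eq (hm k) hPe,
    ← inner_toLp_eq (hm k) hf.coeFn_toLp]
  · have h := Submodule.starProjection_inner_eq_zero (K := orthoSpace μ k) (hf.toLp f) _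
      (reproKernel_mem_orthoSpace hμ k p)
    rw [real_inner_comm, inner_sub_right, sub_eq_zero] at h
    exact h.symm
  · intro j hj
    simp only [Submodule.mem_iInf] at hq2
    rw [← inner_toLp_eq (hm j) hPe]
    exact (Submodule.mem_orthogonal _ _).1 (hq2 j hj) _
      (mem_polySpace_of_polyFun (reproKernel_mem_polyFun μ j p) _)

theorem exists_partialSum_eq {μ : ℝ} (hμ : 0 ≤ μ) {f : ℝ × ℝ → ℝ}
    (hf : MemLp f 2 (diskMeasure μ)) (n : ℕ) :
    ∃ P ∈ MvPolynomial.restrictTotalDegree (Fin 2) ℝ n,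
      partialSum μ n (hf.toLp f) =ᵐ[diskMeasure μ] evalAt P ∧
      ∀ p, evalAt P p
        = ∫ z, f z * ∑ k ∈ Finset.range (n + 1), reproKernel μ k z p ∂(diskMeasure μ) := by
  choose P hP hPe hPv using exists_proj_eq hμ hf
  refine ⟨∑ k ∈ Finset.range (n + 1), P k, Submodule.sum_mem _ fun k hk => ?_, ?_, fun p => ?_⟩
  · have := hP k
    rw [MvPolynomial.mem_restrictTotalDegree] at this ⊢
    exact this.trans (Nat.lt_succ_iff.1 (Finset.mem_range.1 hk))
  · have h : ∀ᵐ z ∂(diskMeasure μ), ∀ k ∈ Finset.range (n + 1),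
        (proj μ k (hf.toLp f)) z = evalAt (P k) z :=
      (ae_ball_iff (Finset.countable_toSet _)).2 fun k _ => hPe k
    unfold partialSum
    filter_upwards [Lp.coeFn_finsetSum (Finset.range (n + 1)) fun k => proj μ k (hf.toLp f), h]
      with z h1 h2
    rw [h1, Finset.sum_apply, Finset.sum_congr rfl h2]
    simp [evalAt]
  · have e : evalAt (∑ k ∈ Finset.range (n + 1), P k) p
        = ∑ k ∈ Finset.range (n + 1), evalAt (P k) p := by simp [evalAt]
    simp only [e, hPv]
    rw [← integral_finsetSum _ fun k _ =>
      integrable_continuous_mul hμ (continuous_reproKernel μ k p) hf]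
    simp only [Finset.mul_sum, mul_comm]

theorem continuous_phiKernel (μ : ℝ) (n : ℕ) (ξ : ℝ) (p : ℝ × ℝ) :
    Continuous fun t => phiKernel μ n ξ t p := by
  unfold phiKernel gegenbauer
  fun_prop

theorem IsQuadrature.integral_mul_sum_reproKernel {μ : ℝ} (hμ : 0 ≤ μ) {n N : ℕ}
    {θ : ℕ → ℝ} (h : IsQuadrature n N θ) (hN : N ≠ 0) {f : ℝ × ℝ → ℝ}
    (hf : MemLp f 2 (diskMeasure μ)) (p : ℝ × ℝ) :
    ∫ z, f z * ∑ k ∈ Finset.range (n + 1), reproKernel μ k z p ∂(diskMeasure μ)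
      = 1 / N * ∑ ν ∈ Finset.range N, aConst μ *
        ∫ t in (-1 : ℝ)..1, radon μ (θ ν) f t * phiKernel μ n (θ ν) t p := by
  have := isFiniteMeasure_diskMeasure hμ
  have hf1 : Integrable f (diskMeasure μ) := hf.integrable (by norm_num)
  have hN' : (N : ℝ) ≠ 0 := Nat.cast_ne_zero.2 hN
  have hc := fun ν => continuous_phiKernel μ n (θ ν) p
  simp only [fun ν => integral_radon_mul hμ hf1 (θ ν) (hc ν)]
  rw [← integral_finsetSum, ← integral_const_mul]
  · congr 1
    ext z
    rw [← Finset.mul_sum, h.sum_phiKernel hμ z p]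
    field_simp
  · intro ν _
    have := integrable_continuous_mul hμ (g := fun z => phiKernel μ n (θ ν)
      (z.1 * Real.cos (θ ν) + z.2 * Real.sin (θ ν)) p) ((hc ν).comp (by fun_prop)) hf
    simpa only [mul_comm] using this

end AttenuatedRadon

end

open AttenuatedRadon in
/-- For `f` in the weighted `L²` space, the attenuated Radon projections exist for almost every `t`
and are integrable against the kernel; the partial sum `S_{2m} f` is the polynomial of degree at
most `2m` whose value at every point is a mean over the `2m+1` directions `φ_ν`, and likewise
`S_n f` is given by means over the `n+1`, and over the `2n+2`, directions `ξ_ν`. -/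
theorem corollary2p11 (μ : ℝ) (hμ : 0 ≤ μ) (f : ℝ × ℝ → ℝ)
    (hf : MeasureTheory.MemLp f 2 (diskMeasure μ)) :
    (∀ θ : ℝ,
      (∀ᵐ t ∂(MeasureTheory.volume.restrict (Set.Icc (-1 : ℝ) 1)),
        IntervalIntegrable (fun s => f (linePoint θ t s) * weight μ (linePoint θ t s))
          MeasureTheory.volume (-√(1 - t ^ 2)) √(1 - t ^ 2)) ∧
      ∀ (n : ℕ) (x y : ℝ), IntervalIntegrable
        (fun t => radon μ θ f t * phiKernel μ n θ t (x, y)) MeasureTheory.volume (-1) 1) ∧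
    (∀ m : ℕ, ∃ P ∈ MvPolynomial.restrictTotalDegree (Fin 2) ℝ (2 * m),
      partialSum μ (2 * m) (hf.toLp f) =ᵐ[diskMeasure μ] evalAt P ∧
      ∀ x y : ℝ, evalAt P (x, y) =
        1 / (2 * m + 1) * ∑ ν ∈ Finset.range (2 * m + 1), aConst μ *
          ∫ t in (-1 : ℝ)..1,
            radon μ (phiAngle m ν) f t * phiKernel μ (2 * m) (phiAngle m ν) t (x, y)) ∧
    (∀ n : ℕ, ∃ P ∈ MvPolynomial.restrictTotalDegree (Fin 2) ℝ n,
      partialSum μ n (hf.toLp f) =ᵐ[diskMeasure μ] evalAt P ∧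
      ∀ x y : ℝ,
        evalAt P (x, y) =
          1 / (n + 1) * ∑ ν ∈ Finset.range (n + 1), aConst μ *
            ∫ t in (-1 : ℝ)..1,
              radon μ (xiAngle n ν) f t * phiKernel μ n (xiAngle n ν) t (x, y) ∧
        evalAt P (x, y) =
          1 / (2 * n + 2) * ∑ ν ∈ Finset.range (2 * n + 2), aConst μ *
            ∫ t in (-1 : ℝ)..1,
              radon μ (xiAngle n ν) f t * phiKernel μ n (xiAngle n ν) t (x, y)) := by
  have := isFiniteMeasure_diskMeasure hμ
  have hf1 : MeasureTheory.Integrable f (diskMeasure μ) := hf.integrable (by norm_num)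
  refine ⟨fun θ => ⟨MeasureTheory.ae_restrict_of_ae (ae_intervalIntegrable_chord hμ hf1 θ),
    fun n x y => (integrable_radon_mul hμ hf1 θ
      (continuous_phiKernel μ n θ (x, y))).intervalIntegrable⟩, fun m => ?_, fun n => ?_⟩
  · obtain ⟨P, hP, hPe, hPv⟩ := exists_partialSum_eq hμ hf (2 * m)
    refine ⟨P, hP, hPe, fun x y => ?_⟩
    have h := (isQuadrature_phiAngle m).integral_mul_sum_reproKernel hμ (by omega) hf (x, y)
    push_cast at h
    rw [hPv, h]
  · obtain ⟨P, hP, hPe, hPv⟩ := exists_partialSum_eq hμ hf n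
    refine ⟨P, hP, hPe, fun x y => ⟨?_, ?_⟩⟩
    · have h := (isQuadrature_xiAngle n).integral_mul_sum_reproKernel hμ (by omega) hf (x, y)
      push_cast at h
      rw [hPv, h]
    · have h := (isQuadrature_xiAngle_two_mul n).integral_mul_sum_reproKernel hμ (by omega) hf
        (x, y)
      push_cast at h
      rw [hPv, h]
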